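/- Let $d\ge 1$ and let $\mathcal V$ be $\mathbb R^d$ (continuum model) or $\mathbb Z^d$ (lattice model). Let $(V_\omega)_{\omega\in\Omega}$ be a random potential on $\mathcal V$, i.e. a family of real functions on $\mathcal V$ indexed by a probability space $(\Omega,\mathbb P)$, and let $H_\omega=-\Delta+V_\omega$, where in the lattice case $(-\Delta\varphi)(x)=\sum_{|y-x|=1}(\varphi(x)-\varphi(y))$. For a bounded domain $\Lambda\subset\mathcal V$ (a bounded open set, respectively a finite set of sites) let $H_\omega(\Lambda,n)$ be the Hamiltonian $\sum_{i=1}^n\bigl(-\Delta_i+V_\omega(x^i)\bigr)$ of $n$ noninteracting fermions in $\Lambda$ with Dirichlet boundary conditions, acting on the antisymmetric subspace $L^2_-(\Lambda^n)$; in the continuum it is the operator associated with the closed quadratic form $\sum_i\int|\nabla_i\varphi|^2+\int\sum_iV_\omega(x^i)|\varphi|^2$ on the antisymmetric functions in $H^1_0(\Lambda^n)$ for which it is finite. Let $$\mathfrak E_\omega(\Lambda,n)=\inf_{0\ne\varphi\in\mathrm{Dom}\,H_\omega(\Lambda,n)}\frac{\langle H_\omega(\Lambda,n)\varphi,\varphi\rangle}{\|\varphi\|^2}\in(-\infty,+\infty]$$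 be its ground state energy ($+\infty$ if there is no such $\varphi$). For $\rho>0$, the thermodynamic limit at density $\rho$ means $n/|\Lambda|\to\rho$ and $\Lambda\to\infty$ in the sense of Fisher: $|\Lambda|\to\infty$, and there is a function $\pi$ with $\lim_{\alpha\to0^+}\pi(\alpha)=0$ such that, for all sufficiently small $\alpha>0$ and all $\Lambda$ of the sequence, the $\alpha\,\mathrm{diam}(\Lambda)$-neighbourhood of $\partial\Lambda$ has volume at most $\pi(\alpha)|\Lambda|$ (a lattice domain is identified with the union of the unit cells of its sites). The energy density $\mathcal E(\rho,0)\in[-\infty,+\infty]$ is the non-random limit of $\mathfrak E_\omega(\Lambda,n)/n$ in the thermodynamic limit at density $\rho$; convergence is understood in probability, which is implied by convergence in $L^2$, in $L^1$ or almost surely. There is a constant $\beta=\beta(d)>0$ such that, for every $\rho>0$ and every random potential with $V_\omega\ge0$ almost surely, in both models, $$\mathcal E(\rho,0)\ \ge\ \beta\,\rho^{2/d}$$ whenever the limit $\mathcal E(\rho,0)$ exists. Moreover, whether or not this limit exists, for almost every $\omega$, $$\liminf\ \frac{\mathfrak E_\omega(\Lambda,n)}{n}\ \ge\ \beta\,\rho^{2/d}$$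 along every sequence $(\Lambda,n)$ in the thermodynamic limit at density $\rho$. -/

import Mathlib

open MeasureTheory Filter Topology
open scoped ComplexConjugate

namespace FermionGas

/-! ## Domains tending to infinity and the thermodynamic limit -/

/-- The one-particle configuration space of the continuum model, with the Euclidean norm. -/
abbrev Space (d : ℕ) : Type := EuclideanSpace ℝ (Fin d)

/-- The sets `Λ k` tend to infinity in the sense of Fisher: their volumes tend to infinity and
there is a shape function `π` with `π α → 0` as `α → 0`, such that for all small `α > 0` and
all `k` the open `α * diam (Λ k)`-neighbourhood of the boundary of `Λ k` has volume at most
`π α * |Λ k|`. -/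
def TendsToInfinityFisher {d : ℕ} (Λ : ℕ → Set (Space d)) : Prop :=
  Tendsto (fun k => volume (Λ k)) atTop (𝓝 ⊤) ∧
  ∃ π : ℝ → ℝ, Tendsto π (𝓝[>] 0) (𝓝 0) ∧
    ∃ α₀ > 0, ∀ α : ℝ, 0 < α → α < α₀ → ∀ k,
      volume (Metric.thickening (α * Metric.diam (Λ k)) (frontier (Λ k))) ≤
        ENNReal.ofReal (π α) * volume (Λ k)

/-- The thermodynamic limit at density `ρ`: `Λ → ∞` in the sense of Fisher, `n / |Λ| → ρ`. -/
def ThermodynamicLimit {d : ℕ} (Λ : ℕ → Set (Space d)) (n : ℕ → ℕ) (ρ : ℝ) : Prop :=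
  TendsToInfinityFisher Λ ∧
  Tendsto (fun k => (n k : ℝ) / (volume (Λ k)).toReal) atTop (𝓝 ρ)

/-- `e` is the limiting energy density at particle density `ρ` of the random energies
`𝓔 ω Λ n` (`n` particles in the domain `Λ`): along every thermodynamic limit `𝓔 ω Λ n / n`
converges to the non-random number `e`. The values may be infinite, so convergence is required
in probability in the extended reals; it follows from `L²`, from `L¹` and from almost sure
convergence. `region Λ` is the subset of Euclidean space occupied by the domain `Λ`. -/
def IsEnergyDensity {Ω : Type*} [MeasurableSpace Ω] (P : Measure Ω) {d : ℕ} {D : Type}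
    (region : D → Set (Space d)) (𝓔 : Ω → D → ℕ → EReal) (ρ : ℝ) (e : EReal) : Prop :=
  ∀ (Λ : ℕ → D) (n : ℕ → ℕ), ThermodynamicLimit (fun k => region (Λ k)) n ρ →
    ∀ U ∈ 𝓝 e,
      Tendsto (fun k => P {ω | 𝓔 ω (Λ k) (n k) / ((n k : ℝ) : EReal) ∉ U}) atTop (𝓝 0)

/-! ## Noninteracting fermions on `ℝ ^ d` -/

/-- Bounded open subsets of `ℝ ^ d`. -/
structure Domain (d : ℕ) : Type where
  carrier : Set (Space d)
  isOpen : IsOpen carrier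
  isBounded : Bornology.IsBounded carrier

/-- Positions of `n` particles. -/
abbrev Config (d n : ℕ) : Type := Fin n → Space d

/-- The set `Λ ^ n` of configurations of `n` particles in `Λ`. -/
def boxPow {d : ℕ} (Λ : Domain d) (n : ℕ) : Set (Config d n) :=
  Set.univ.pi fun _ => Λ.carrier

/-- Lebesgue measure on `Λ ^ n`. -/
noncomputable def boxMeasure {d : ℕ} (Λ : Domain d) (n : ℕ) : Measure (Config d n) :=
  (volume : Measure (Config d n)).restrict (boxPow Λ n)

/-- The Hilbert space `L²(Λ ^ n)` of complex-valued wave functions. -/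
abbrev L2 {d : ℕ} (Λ : Domain d) (n : ℕ) : Type := Lp ℂ 2 (boxMeasure Λ n)

/-- The fermionic wave functions: permuting the particles multiplies the function by the sign
of the permutation. -/
def IsAntisymmetric {d : ℕ} {Λ : Domain d} {n : ℕ} (φ : L2 Λ n) : Prop :=
  ∀ s : Equiv.Perm (Fin n), ∀ᵐ x ∂(boxMeasure Λ n),
    φ (fun i => x (s i)) = (((Equiv.Perm.sign s : ℤ) : ℂ)) * φ x

/-- Pairs `(g, ∇ g)` with `g` smooth with compact support in `Λ ^ n`; the component `(i, j)` of
the gradient is the derivative in the `j`-th coordinate of the `i`-th particle. -/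
def testGraph {d : ℕ} (Λ : Domain d) (n : ℕ) : Set (L2 Λ n × (Fin n → Fin d → L2 Λ n)) :=
  {p | ∃ g : Config d n → ℂ, ContDiff ℝ (⊤ : ℕ∞) g ∧ HasCompactSupport g ∧ tsupport g ⊆ boxPow Λ n ∧
    p.1 =ᵐ[boxMeasure Λ n] g ∧
    ∀ i j, p.2 i j =ᵐ[boxMeasure Λ n]
      fun x => fderiv ℝ g x (Pi.single i (EuclideanSpace.single j 1))}

/-- `φ` belongs to the Sobolev space `H¹₀(Λ ^ n)` (the closure of the test functions in the
`H¹` norm) and has weak gradient `u`. -/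
def HasDirichletGradient {d : ℕ} {Λ : Domain d} {n : ℕ} (φ : L2 Λ n)
    (u : Fin n → Fin d → L2 Λ n) : Prop :=
  (φ, u) ∈ closure (testGraph Λ n)

/-- `φ` is in the form domain of the `n`-fermion Dirichlet Hamiltonian in `Λ` with one-particle
potential `V`, and has weak gradient `u`. -/
def InFormDomain {d : ℕ} {Λ : Domain d} {n : ℕ} (V : Space d → ℝ) (φ : L2 Λ n)
    (u : Fin n → Fin d → L2 Λ n) : Prop :=
  IsAntisymmetric φ ∧ HasDirichletGradient φ u ∧
    Integrable (fun x => (∑ i, V (x i)) * ‖φ x‖ ^ 2) (boxMeasure Λ n)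

/-- The graph of the `n`-fermion Dirichlet Hamiltonian
`H = ∑ i, (- Δ_i + V (x i))` on the antisymmetric part of `L²(Λ ^ n)`, for `V ≥ 0`: the operator
of the closed quadratic form
`q (φ, ψ) = ∑ i, ∫ ⟨∇_i φ, ∇_i ψ⟩ + ∫ (∑ i, V (x i)) * conj φ * ψ`. So `φ` is in the domain of
`H` and `H φ = f` when `φ` is in the form domain and `q (φ, ψ) = ⟨f, ψ⟩` for every `ψ` in the
form domain. -/
def hamiltonianGraph {d : ℕ} (V : Space d → ℝ) (Λ : Domain d) (n : ℕ) :
    Set (L2 Λ n × L2 Λ n) :=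
  {p | IsAntisymmetric p.2 ∧ ∃ u : Fin n → Fin d → L2 Λ n, InFormDomain V p.1 u ∧
    ∀ (ψ : L2 Λ n) (w : Fin n → Fin d → L2 Λ n), InFormDomain V ψ w →
      (∑ i, ∑ j, inner ℂ (u i j) (w i j)) +
        ∫ x, ((∑ i, V (x i) : ℝ) : ℂ) * (conj (p.1 x) * ψ x) ∂(boxMeasure Λ n) =
      inner ℂ p.2 ψ}

/-- The ground state energy: the infimum of `⟨H φ, φ⟩ / ‖φ‖²` over the nonzero `φ` in the domain
of `H`. It is `+∞` when there is no such `φ`. -/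
noncomputable def groundEnergy {d : ℕ} (V : Space d → ℝ) (Λ : Domain d) (n : ℕ) : EReal :=
  ⨅ p : {p : L2 Λ n × L2 Λ n // p ∈ hamiltonianGraph V Λ n ∧ p.1 ≠ 0},
    (((inner ℂ p.1.2 p.1.1).re / ‖p.1.1‖ ^ 2 : ℝ) : EReal)

/-! ## Noninteracting fermions on `ℤ ^ d` -/

/-- The lattice `ℤ ^ d`. -/
abbrev Lattice (d : ℕ) : Type := Fin d → ℤ

/-- A set of lattice sites, seen as the union of the unit cells of its sites. -/
def cells {d : ℕ} (Λ : Finset (Lattice d)) : Set (Space d) :=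
  {x | (fun j => ⌊x j⌋) ∈ Λ}

/-- The lattice vector that moves the `i`-th particle by one step in direction `j`. -/
def latticeStep {d n : ℕ} (i : Fin n) (j : Fin d) : Fin n → Lattice d :=
  Pi.single i (Pi.single j 1)

/-- The `n`-particle Hamiltonian `∑ i, (- Δ_i + V (x i))` with the discrete Laplacian
`(- Δ φ) (x) = ∑ (φ x - φ y)`, the sum over the nearest neighbours `y` of `x`. -/
noncomputable def latticeHamiltonian {d n : ℕ} (V : Lattice d → ℝ)
    (φ : (Fin n → Lattice d) → ℂ) (x : Fin n → Lattice d) : ℂ :=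
  ∑ i, ((∑ j, ((φ x - φ (x + latticeStep i j)) + (φ x - φ (x - latticeStep i j)))) +
    (V (x i) : ℂ) * φ x)

/-- The fermionic wave functions of `n` particles in `Λ`, extended by zero to the whole
lattice (Dirichlet condition). -/
def latticeFermions {d : ℕ} (Λ : Finset (Lattice d)) (n : ℕ) :
    Set ((Fin n → Lattice d) → ℂ) :=
  {φ | (∀ x, (∃ i, x i ∉ Λ) → φ x = 0) ∧
    ∀ (s : Equiv.Perm (Fin n)) (x : Fin n → Lattice d),
      φ (fun i => x (s i)) = (((Equiv.Perm.sign s : ℤ) : ℂ)) * φ x}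

/-- The ground state energy of `n` lattice fermions in `Λ`: the infimum of `⟨H φ, φ⟩ / ‖φ‖²` over
the nonzero fermionic wave functions in `Λ`, where `H` is the restriction of the Hamiltonian to
`ℓ²(Λ ^ n)`. It is `+∞` when there is no nonzero one, that is, when `n > |Λ|`. -/
noncomputable def latticeGroundEnergy {d : ℕ} (V : Lattice d → ℝ) (Λ : Finset (Lattice d))
    (n : ℕ) : EReal :=
  ⨅ φ : {φ : (Fin n → Lattice d) → ℂ // φ ∈ latticeFermions Λ n ∧ φ ≠ 0},
    (((∑ x ∈ Fintype.piFinset fun _ => Λ, conj (latticeHamiltonian V φ.1 x) * φ.1 x).re /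
      (∑ x ∈ Fintype.piFinset fun _ => Λ, ‖φ.1 x‖ ^ 2) : ℝ) : EReal)

end FermionGas

/-!
By the Pauli principle a one-particle state is occupied by at most one fermion. Taking the indicator
functions of the windows `Λ ∩ (B - a)` as one-particle states and averaging over `a`, one finds that
a wave function of `n` fermions in `Λ` which changes little when one particle is moved by a
difference of two elements of `B` satisfies, approximately, `n * |B| ≤ |Λ|`. The change under such a
move is controlled by the size of `B` and the kinetic energy. For a cube `B` of volume `2 * |Λ| / n`
the particles are twice too many, so the wave function must change, and the kinetic energy per
particle is at least a constant times the inverse square of the side of `B`, that is a constant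
times `(n / |Λ|) ^ (2 / d)`. A nonnegative potential only increases the energy.
-/

namespace FermionGas

/-! ## The exclusion principle -/

theorem sum_inner_le_norm_sq {ι H : Type*} [Fintype ι] [NormedAddCommGroup H]
    [InnerProductSpace ℝ H] (w₀ : H) (w : ι → H) (hnorm : ∀ i, ‖w i‖ = ‖w₀‖)
    (hinner : ∀ i j, i ≠ j → inner ℝ (w i) (w j) = -inner ℝ w₀ (w j)) :
    ∑ i, inner ℝ w₀ (w i) ≤ ‖w₀‖ ^ 2 := by
  classical
  set S := ∑ i, inner ℝ w₀ (w i) with hS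
  have hsum : inner ℝ w₀ (∑ i, w i) = S := inner_sum _ _ _
  have hrow (i : ι) : inner ℝ (w i) (∑ j, w j) = ‖w₀‖ ^ 2 + inner ℝ w₀ (w i) - S := by
    rw [inner_sum, hS, ← Finset.add_sum_erase _ _ (Finset.mem_univ i),
      ← Finset.add_sum_erase _ (fun j => inner ℝ w₀ (w j)) (Finset.mem_univ i),
      real_inner_self_eq_norm_sq, hnorm,
      Finset.sum_congr rfl fun j hj => hinner i j (Finset.ne_of_mem_erase hj).symm,
      Finset.sum_neg_distrib]
    ring
  -- If `w i` is `w₀` after the exchange of the `i`-th and an additional fermion, then `w₀ - ∑ w i`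
  -- is a multiple of the antisymmetrization of `w₀`.
  have hexpand : ‖w₀ - ∑ i, w i‖ ^ 2 = (Fintype.card ι + 1) * (‖w₀‖ ^ 2 - S) := by
    rw [norm_sub_sq_real, hsum, ← real_inner_self_eq_norm_sq (∑ i, w i), sum_inner]
    simp only [hrow, Finset.sum_sub_distrib, Finset.sum_add_distrib, Finset.sum_const,
      Finset.card_univ, nsmul_eq_mul, ← hS]
    ring
  have hpos : (0 : ℝ) < Fintype.card ι + 1 := by positivity
  exact sub_nonneg.1 ((mul_nonneg_iff_of_pos_left hpos).1 (hexpand ▸ sq_nonneg _))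

section

variable {Z F : Type*} [MeasurableSpace Z] {ν : Measure Z} [NormedAddCommGroup F]
  [InnerProductSpace ℝ F]

theorem inner_toLp_toLp {u v : Z → F} (hu : MemLp u 2 ν) (hv : MemLp v 2 ν) :
    inner ℝ (hu.toLp u) (hv.toLp v) = ∫ z, inner ℝ (u z) (v z) ∂ν := by
  rw [L2.inner_def]
  refine integral_congr_ae ?_
  filter_upwards [hu.coeFn_toLp, hv.coeFn_toLp] with z hz hz'
  rw [hz, hz']

theorem sum_integral_inner_comp_le {ι : Type*} [Fintype ι] {S : ι → Z → Z}
    (hS : ∀ i, MeasurePreserving (S i) ν ν) (hinv : ∀ i, Function.Involutive (S i))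
    {w : Z → F} (hw : MemLp w 2 ν)
    (hanti : ∀ i j, i ≠ j → ∀ᵐ z ∂ν, w (S j (S i z)) = -w (S j z)) :
    ∑ i, ∫ z, inner ℝ (w z) (w (S i z)) ∂ν ≤ (eLpNorm w 2 ν).toReal ^ 2 := by
  have hwS (i : ι) : MemLp (w ∘ S i) 2 ν := hw.comp_measurePreserving (hS i)
  have key := sum_inner_le_norm_sq (hw.toLp w) (fun i => (hwS i).toLp _) ?_ ?_
  · simpa only [inner_toLp_toLp, Lp.norm_toLp, Function.comp_apply] using key
  · intro i
    rw [Lp.norm_toLp, Lp.norm_toLp, eLpNorm_comp_measurePreserving hw.1 (hS i)]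
  · intro i j hij
    let e : Z ≃ᵐ Z := ⟨(hinv i).toPerm, (hS i).measurable, (hS i).measurable⟩
    have he : MeasurePreserving e ν ν := hS i
    rw [inner_toLp_toLp, inner_toLp_toLp, ← he.integral_comp', ← integral_neg]
    refine integral_congr_ae ?_
    filter_upwards [hanti i j hij] with z hz
    change inner ℝ (w (S i (S i z))) (w (S j (S i z))) = -inner ℝ (w z) (w (S j z))
    rw [hinv i z, hz, inner_neg_right]

theorem two_mul_eLpNorm_sq_eq_of_measurePreserving {S : Z → Z} (hS : MeasurePreserving S ν ν)
    {u : Z → F} (hu : MemLp u 2 ν) :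
    2 * (eLpNorm u 2 ν).toReal ^ 2 =
      2 * ∫ z, inner ℝ (u z) (u (S z)) ∂ν + (eLpNorm (u - u ∘ S) 2 ν).toReal ^ 2 := by
  have huS : MemLp (u ∘ S) 2 ν := hu.comp_measurePreserving hS
  have hnorm : ‖huS.toLp _‖ = ‖hu.toLp _‖ := by
    rw [Lp.norm_toLp, Lp.norm_toLp, eLpNorm_comp_measurePreserving hu.1 hS]
  have hinner : inner ℝ (hu.toLp u) (huS.toLp _) = ∫ z, inner ℝ (u z) (u (S z)) ∂ν :=
    inner_toLp_toLp hu huS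
  have hsub := norm_sub_sq_real (hu.toLp u) (huS.toLp _)
  rw [← MemLp.toLp_sub hu huS, hnorm, hinner, Lp.norm_toLp, Lp.norm_toLp] at hsub
  linarith

end

section

variable {ι X A : Type*} [DecidableEq ι]

/-- The exchange of the `i`-th particle of a configuration with an additional particle; the third
component of the point is a spectator. -/
def exchange (i : ι) (p : (ι → X) × X × A) : (ι → X) × X × A :=
  (Function.update p.1 i p.2.1, p.1 i, p.2.2)

theorem exchange_involutive (i : ι) : Function.Involutive (exchange (X := X) (A := A) i) := by
  intro p
  simp [exchange]

theorem exchange_exchange_fst {i j : ι} (hij : i ≠ j) (p : (ι → X) × X × A) :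
    (exchange j (exchange i p)).1 = (exchange j p).1 ∘ Equiv.swap i j := by
  funext k
  simp only [exchange, Function.comp]
  rcases eq_or_ne k i with rfl | hki
  · simp [hij]
  rcases eq_or_ne k j with rfl | hkj
  · simp [hij]
  · simp [Equiv.swap_apply_of_ne_of_ne hki hkj, hki, hkj]

variable [Fintype ι] [MeasurableSpace X]

theorem measurePreserving_update_prod (μ : Measure X) [SigmaFinite μ] (i : ι) :
    MeasurePreserving (fun p : (ι → X) × X => (Function.update p.1 i p.2, p.1 i))
      ((Measure.pi fun _ : ι => μ).prod μ) ((Measure.pi fun _ : ι => μ).prod μ) := by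
  let e := MeasurableEquiv.piOptionEquivProd fun _ : Option ι => X
  have he : MeasurePreserving e.symm ((Measure.pi fun _ : ι => μ).prod μ)
      (Measure.pi fun _ : Option ι => μ) :=
    ⟨e.symm.measurable, Measure.pi_map_piOptionEquivProd fun _ => μ⟩
  have hswap : MeasurePreserving (fun x : Option ι → X => x ∘ Equiv.swap none (some i))
      (Measure.pi fun _ => μ) (Measure.pi fun _ => μ) :=
    (measurePreserving_piCongrLeft (fun _ : Option ι => μ) (Equiv.swap none (some i))).symm
  convert (he.symm e.symm).comp (hswap.comp he) using 1
  funext p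
  refine Prod.ext (funext fun k => ?_) ?_
  · change Function.update p.1 i p.2 k = e.symm p (Equiv.swap none (some i) (some k))
    rcases eq_or_ne k i with rfl | hki
    · rw [Function.update_self, Equiv.swap_apply_right]
      rfl
    · rw [Function.update_of_ne hki, Equiv.swap_apply_of_ne_of_ne (by simp) (by simpa)]
      rfl
  · change p.1 i = e.symm p (Equiv.swap none (some i) none)
    rw [Equiv.swap_apply_left]
    rfl

variable [MeasurableSpace A]

theorem measurePreserving_exchange (μ : Measure X) [SigmaFinite μ] (κ : Measure A) [SFinite κ]
    (i : ι) :
    MeasurePreserving (exchange i) ((Measure.pi fun _ : ι => μ).prod (μ.prod κ))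
      ((Measure.pi fun _ : ι => μ).prod (μ.prod κ)) := by
  have hassoc := measurePreserving_prodAssoc (Measure.pi fun _ : ι => μ) μ κ
  have hpair := (measurePreserving_update_prod μ i).prod (MeasurePreserving.id κ)
  exact hassoc.comp (hpair.comp (hassoc.symm MeasurableEquiv.prodAssoc))

end

section

variable {Y C F : Type*} [MeasurableSpace Y] [MeasurableSpace C] [NormedAddCommGroup F]
  {π : Measure Y} {κ : Measure C}

theorem eLpNorm_two_sq_eq_lintegral (f : Y → F) :
    eLpNorm f 2 π ^ 2 = ∫⁻ y, ‖f y‖ₑ ^ 2 ∂π := by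
  simpa using eLpNorm_nnreal_pow_eq_lintegral (f := f) (μ := π) (p := 2) two_ne_zero

theorem toReal_eLpNorm_two_comp_fst_sq [SFinite κ] {f : Y → F} (hf : AEStronglyMeasurable f π) :
    (eLpNorm (fun q => f q.1) 2 (π.prod κ)).toReal ^ 2 =
      κ.real Set.univ * (eLpNorm f 2 π).toReal ^ 2 := by
  have hmap : Measure.map Prod.fst (π.prod κ) = κ Set.univ • π := Measure.map_fst_prod
  have hcomp : eLpNorm (fun q => f q.1) 2 (π.prod κ) = eLpNorm f 2 (κ Set.univ • π) := by
    rw [← hmap, eLpNorm_map_measure (hmap ▸ hf.smul_measure _) measurable_fst.aemeasurable]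
    rfl
  rw [hcomp, eLpNorm_smul_measure_of_ne_top ENNReal.ofNat_ne_top, smul_eq_mul,
    ENNReal.toReal_mul, mul_pow, ← ENNReal.toReal_rpow, ← Real.rpow_natCast,
    ← Real.rpow_mul ENNReal.toReal_nonneg]
  simp [measureReal_def]

theorem toReal_eLpNorm_two_prod_sq_le [SFinite π] [IsFiniteMeasure κ] {g : Y × C → F}
    (hg : AEStronglyMeasurable g (π.prod κ)) {D : ℝ}
    (hD : ∀ᵐ c ∂κ, eLpNorm (fun y => g (y, c)) 2 π ≤ ENNReal.ofReal D) :
    (eLpNorm g 2 (π.prod κ)).toReal ^ 2 ≤ κ.real Set.univ * D ^ 2 := by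
  have hle : eLpNorm g 2 (π.prod κ) ^ 2 ≤ ENNReal.ofReal (κ.real Set.univ * D ^ 2) := by
    calc eLpNorm g 2 (π.prod κ) ^ 2
        = ∫⁻ c, eLpNorm (fun y => g (y, c)) 2 π ^ 2 ∂κ := by
          rw [eLpNorm_two_sq_eq_lintegral, lintegral_prod_symm _ (hg.enorm.pow_const 2)]
          simp only [eLpNorm_two_sq_eq_lintegral]
      _ ≤ ∫⁻ _, ENNReal.ofReal (D ^ 2) ∂κ := by
          refine lintegral_mono_ae (hD.mono fun c hc => ?_)
          calc _ ≤ ENNReal.ofReal D ^ 2 := by gcongr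
            _ ≤ ENNReal.ofReal |D| ^ 2 := by gcongr; exact le_abs_self D
            _ = ENNReal.ofReal (D ^ 2) := by rw [← ENNReal.ofReal_pow (abs_nonneg D), sq_abs]
      _ = ENNReal.ofReal (κ.real Set.univ * D ^ 2) := by
          rw [lintegral_const, mul_comm, ENNReal.ofReal_mul measureReal_nonneg, ofReal_measureReal]
  rw [← ENNReal.toReal_pow]
  exact ENNReal.toReal_le_of_le_ofReal (by positivity) hle

theorem quasiMeasurePreserving_add_comp [AddGroup Y] [MeasurableAdd₂ Y] [π.IsAddRightInvariant]
    [SFinite π] [SFinite κ] {f : C → Y} (hf : Measurable f) :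
    Measure.QuasiMeasurePreserving (fun q : Y × C => q.1 + f q.2) (π.prod κ) π :=
  QuasiMeasurePreserving.prod_of_left (by fun_prop) <| .of_forall fun c =>
    (measurePreserving_add_right π (f c)).quasiMeasurePreserving

end

section

variable {ι X A F : Type*} [DecidableEq ι]

/-- The exchange of any two particles changes the sign of the wave function `φ`. -/
def IsAlternating [Fintype ι] [MeasurableSpace X] [Neg F] (μ : Measure X) (φ : (ι → X) → F) :
    Prop :=
  ∀ i j, i ≠ j → ∀ᵐ x ∂Measure.pi fun _ : ι => μ, φ (x ∘ Equiv.swap i j) = -φ x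

/-- The wave function `φ` of some particles, times the indicator function of `E` as wave function
of an additional particle. The spectator coordinate allows averaging over a family of such
one-particle states. -/
noncomputable def windowed [Zero F] (E : Set (X × A)) (φ : (ι → X) → F) (p : (ι → X) × X × A) : F :=
  E.indicator (fun _ => φ p.1) p.2

variable [Fintype ι] [MeasurableSpace X] [MeasurableSpace A] [NormedAddCommGroup F]
  {μ : Measure X} [SigmaFinite μ] {κ : Measure A} [SFinite κ] {φ : (ι → X) → F} {E : Set (X × A)}

theorem windowed_exchange_exchange (hφ : IsAlternating μ φ) {i j : ι} (hij : i ≠ j) :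
    ∀ᵐ p ∂(Measure.pi fun _ : ι => μ).prod (μ.prod κ),
      windowed E φ (exchange j (exchange i p)) = -windowed E φ (exchange j p) := by
  have hfst := Measure.quasiMeasurePreserving_fst.comp
    (measurePreserving_exchange μ κ j).quasiMeasurePreserving
  filter_upwards [hfst.ae (hφ i j hij)] with p hp
  have hsnd : (exchange j (exchange i p)).2 = (exchange j p).2 := by simp [exchange, hij.symm]
  rw [windowed, windowed, hsnd, exchange_exchange_fst hij]
  by_cases hE : (exchange j p).2 ∈ E
  · rw [Set.indicator_of_mem hE, Set.indicator_of_mem hE]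
    exact hp
  · simp only [Set.indicator_of_notMem hE, neg_zero]

theorem sum_integral_inner_windowed_le [InnerProductSpace ℝ F]
    (hL : MemLp φ 2 (Measure.pi fun _ : ι => μ))
    (hφ : IsAlternating μ φ) (hE : MeasurableSet E) (hE' : μ.prod κ E ≠ ⊤) :
    ∑ i, ∫ p, inner ℝ (windowed E φ p) (windowed E φ (exchange i p))
        ∂(Measure.pi fun _ : ι => μ).prod (μ.prod κ) ≤
      (μ.prod κ).real E * (eLpNorm φ 2 (Measure.pi fun _ : ι => μ)).toReal ^ 2 := by
  have : IsFiniteMeasure ((μ.prod κ).restrict E) := ⟨by simpa using hE'.lt_top⟩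
  have hw : (windowed E φ : (ι → X) × X × A → F) =
      (Set.univ ×ˢ E).indicator fun p => φ p.1 := by
    funext p
    by_cases hp : p.2 ∈ E <;> simp [windowed, hp]
  have hrestrict : ((Measure.pi fun _ : ι => μ).prod (μ.prod κ)).restrict (Set.univ ×ˢ E) =
      (Measure.pi fun _ : ι => μ).prod ((μ.prod κ).restrict E) := by
    rw [← Measure.prod_restrict, Measure.restrict_univ]
  have hwL : MemLp (windowed E φ) 2 ((Measure.pi fun _ : ι => μ).prod (μ.prod κ)) := by
    rw [hw, memLp_indicator_iff_restrict (MeasurableSet.univ.prod hE), hrestrict]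
    exact hL.comp_fst _
  have hnorm := toReal_eLpNorm_two_comp_fst_sq (κ := (μ.prod κ).restrict E) hL.1
  rw [← hrestrict, ← eLpNorm_indicator_eq_eLpNorm_restrict (MeasurableSet.univ.prod hE), ← hw,
    measureReal_restrict_apply_univ] at hnorm
  rw [← hnorm]
  exact sum_integral_inner_comp_le (measurePreserving_exchange μ κ) exchange_involutive hwL
    fun i j hij => windowed_exchange_exchange hφ hij

end

/-- The `Lᵖ` distance between `φ` and its translate by `v`. -/
noncomputable def translationModulus {G F : Type*} [Add G] [MeasurableSpace G]
    [NormedAddCommGroup F] (p : ENNReal) (μ : Measure G) (φ : G → F) (v : G) : ENNReal :=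
  eLpNorm (fun x => φ x - φ (x + v)) p μ

/-- The pairs `(y, a)` with `y ∈ Λ` for which `y` lies in the translate `B - a` of `B`. -/
def slidingWindow {X : Type*} [Add X] (Λ B : Set X) : Set (X × X) :=
  {q | q.1 ∈ Λ ∧ q.1 + q.2 ∈ B}

section

variable {X : Type*} [MeasurableSpace X]

theorem measurableSet_slidingWindow [Add X] [MeasurableAdd₂ X] {Λ B : Set X}
    (hΛ : MeasurableSet Λ) (hB : MeasurableSet B) : MeasurableSet (slidingWindow Λ B) :=
  (measurable_fst hΛ).inter (measurable_add hB)

theorem measure_slidingWindow [AddGroup X] [MeasurableAdd₂ X] (μ : Measure X) [SFinite μ]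
    [μ.IsAddLeftInvariant] {Λ B : Set X} (hΛ : MeasurableSet Λ) (hB : MeasurableSet B) :
    μ.prod μ (slidingWindow Λ B) = μ Λ * μ B := by
  rw [← Measure.prod_prod,
    ← (measurePreserving_prod_add μ μ).measure_preimage (hΛ.prod hB).nullMeasurableSet]
  rfl

end

section

variable {ι X F : Type*}

/-- The change of variables `(x, y, a) ↦ (x, y + a, x i + a)`, which replaces the window parameter
`a` by the positions of the additional particle `y` and of the `i`-th particle relative to it. -/
def windowShear [Add X] (i : ι) (p : (ι → X) × X × X) : (ι → X) × X × X :=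
  (p.1, p.2.1 + p.2.2, p.1 i + p.2.2)

section

variable [DecidableEq ι]

theorem update_eq_add_single [AddCommGroup X] (x : ι → X) (i : ι) (y : X) :
    Function.update x i y = x + Pi.single i (y - x i) := by
  funext k
  rcases eq_or_ne k i with rfl | hki
  · simp
  · simp [hki]

theorem exchange_fst_eq_add_single [AddCommGroup X] (i : ι) (p : (ι → X) × X × X) :
    (exchange i p).1 = p.1 + Pi.single i ((windowShear i p).2.1 - (windowShear i p).2.2) := by
  simp only [exchange, windowShear, update_eq_add_single, add_sub_add_right_eq_sub]

theorem inner_windowed_slidingWindow_exchange [Add X] [NormedAddCommGroup F]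
    [InnerProductSpace ℝ F] {φ : (ι → X) → F} {Λ B : Set X}
    (hsupp : ∀ x, (∃ i, x i ∉ Λ) → φ x = 0) (i : ι) (p : (ι → X) × X × X) :
    inner ℝ (windowed (slidingWindow Λ B) φ p) (windowed (slidingWindow Λ B) φ (exchange i p)) =
      (windowShear i ⁻¹' (Set.univ ×ˢ (B ×ˢ B))).indicator
        (fun p => inner ℝ (φ p.1) (φ (exchange i p).1)) p := by
  have hy : p.2.1 ∉ Λ → φ (exchange i p).1 = 0 := fun h => hsupp _ ⟨i, by simpa [exchange] using h⟩
  have hx : p.1 i ∉ Λ → φ p.1 = 0 := fun h => hsupp _ ⟨i, h⟩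
  by_cases hp : p ∈ windowShear i ⁻¹' (Set.univ ×ˢ (B ×ˢ B))
  · rw [Set.indicator_of_mem hp]
    obtain ⟨-, hyB, hxB⟩ := hp
    by_cases hyΛ : p.2.1 ∈ Λ
    · by_cases hxΛ : p.1 i ∈ Λ
      · rw [windowed, windowed, Set.indicator_of_mem (show p.2 ∈ slidingWindow Λ B from ⟨hyΛ, hyB⟩),
          Set.indicator_of_mem (show (exchange i p).2 ∈ slidingWindow Λ B from ⟨hxΛ, hxB⟩)]
      · simp [windowed, hx hxΛ]
    · simp [windowed, hy hyΛ]
  · rw [Set.indicator_of_notMem hp]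
    by_cases hyB : p.2.1 + p.2.2 ∈ B
    · have hxB : (exchange i p).2 ∉ slidingWindow Λ B := fun h => hp ⟨Set.mem_univ _, hyB, h.2⟩
      rw [windowed, windowed, Set.indicator_of_notMem hxB, inner_zero_right]
    · rw [windowed, Set.indicator_of_notMem fun h : p.2 ∈ _ => hyB h.2, inner_zero_left]

end

variable [Fintype ι] [MeasurableSpace X]

/-- The restriction of `μ ^ ι × μ × μ` to the points `(x, y, a)` for which the `i`-th particle and
the additional particle `y` both lie in the window `B - a`. -/
noncomputable def windowMeasure [Add X] (μ : Measure X) (B : Set X) (i : ι) :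
    Measure ((ι → X) × X × X) :=
  ((Measure.pi fun _ : ι => μ).prod (μ.prod μ)).restrict
    (windowShear i ⁻¹' (Set.univ ×ˢ (B ×ˢ B)))

variable [AddCommGroup X] [MeasurableAdd₂ X] {μ : Measure X} [SigmaFinite μ]
  [μ.IsAddLeftInvariant] {B : Set X}

theorem measurePreserving_windowShear (i : ι) :
    MeasurePreserving (windowShear i) ((Measure.pi fun _ : ι => μ).prod (μ.prod μ))
      ((Measure.pi fun _ : ι => μ).prod (μ.prod μ)) := by
  refine (MeasurePreserving.id _).skew_product
    (g := fun (x : ι → X) (q : X × X) => (q.1 + q.2, x i + q.2))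
    (by fun_prop) (.of_forall fun x => ?_)
  have hadd : MeasurePreserving (fun q : X × X => (q.1, x i + q.2)) (μ.prod μ) (μ.prod μ) :=
    (MeasurePreserving.id μ).prod (measurePreserving_add_left μ (x i))
  exact (hadd.comp (measurePreserving_add_prod μ μ)).map_eq

theorem measurePreserving_windowShear_windowMeasure (hB : MeasurableSet B) (i : ι) :
    MeasurePreserving (windowShear i) (windowMeasure μ B i)
      ((Measure.pi fun _ : ι => μ).prod ((μ.prod μ).restrict (B ×ˢ B))) := by
  have := (measurePreserving_windowShear (μ := μ) i).restrict_preimage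
    (MeasurableSet.univ.prod (hB.prod hB))
  rwa [← Measure.prod_restrict, Measure.restrict_univ] at this

theorem memLp_fst_windowMeasure [NormedAddCommGroup F] {φ : (ι → X) → F}
    (hL : MemLp φ 2 (Measure.pi fun _ : ι => μ)) (hB : MeasurableSet B) (hB' : μ B ≠ ⊤) (i : ι) :
    MemLp (fun p => φ p.1) 2 (windowMeasure μ B i) := by
  have : IsFiniteMeasure ((μ.prod μ).restrict (B ×ˢ B)) :=
    ⟨by simpa [Measure.prod_prod] using ENNReal.mul_lt_top hB'.lt_top hB'.lt_top⟩
  have hshear := measurePreserving_windowShear_windowMeasure (μ := μ) hB i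
  have hfst : MemLp (φ ∘ Prod.fst)
      2 ((Measure.pi fun _ : ι => μ).prod ((μ.prod μ).restrict (B ×ˢ B))) := hL.comp_fst _
  exact (hfst.comp_measurePreserving hshear : MemLp ((φ ∘ Prod.fst) ∘ windowShear i) 2 _)

theorem toReal_eLpNorm_fst_windowMeasure_sq [NormedAddCommGroup F] {φ : (ι → X) → F}
    (hφ : AEStronglyMeasurable φ (Measure.pi fun _ : ι => μ)) (hB : MeasurableSet B) (i : ι) :
    (eLpNorm (fun p => φ p.1) 2 (windowMeasure μ B i)).toReal ^ 2 =
      μ.real B ^ 2 * (eLpNorm φ 2 (Measure.pi fun _ : ι => μ)).toReal ^ 2 := by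
  have hnorm := toReal_eLpNorm_two_comp_fst_sq (κ := (μ.prod μ).restrict (B ×ˢ B)) hφ
  rw [measureReal_restrict_apply_univ, measureReal_prod_prod, ← sq, ← eLpNorm_comp_measurePreserving
    hφ.comp_fst (measurePreserving_windowShear_windowMeasure hB i)] at hnorm
  exact hnorm

variable [DecidableEq ι]

theorem measurePreserving_exchange_windowMeasure (hB : MeasurableSet B) (i : ι) :
    MeasurePreserving (exchange i) (windowMeasure μ B i) (windowMeasure μ B i) := by
  have hpre : exchange i ⁻¹' (windowShear i ⁻¹' (Set.univ ×ˢ (B ×ˢ B))) =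
      windowShear i ⁻¹' (Set.univ ×ˢ (B ×ˢ B)) := by
    ext p
    simp [exchange, windowShear, and_comm]
  have := (measurePreserving_exchange μ μ i).restrict_preimage
    ((measurePreserving_windowShear (μ := μ) i).measurable (MeasurableSet.univ.prod (hB.prod hB)))
  rwa [hpre] at this

variable [MeasurableSub₂ X] [NormedAddCommGroup F] {φ : (ι → X) → F} {Λ : Set X}

theorem toReal_eLpNorm_sub_exchange_windowMeasure_sq_le
    (hφ : AEStronglyMeasurable φ (Measure.pi fun _ : ι => μ)) (hB : MeasurableSet B)
    (hB' : μ B ≠ ⊤) (i : ι) {D : ℝ}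
    (hD : ∀ b ∈ B, ∀ b' ∈ B, translationModulus 2 (Measure.pi fun _ : ι => μ) φ
      (Pi.single i (b - b')) ≤ ENNReal.ofReal D) :
    (eLpNorm (fun p => φ p.1 - φ (exchange i p).1) 2 (windowMeasure μ B i)).toReal ^ 2 ≤
      μ.real B ^ 2 * D ^ 2 := by
  have : IsFiniteMeasure ((μ.prod μ).restrict (B ×ˢ B)) :=
    ⟨by simpa [Measure.prod_prod] using ENNReal.mul_lt_top hB'.lt_top hB'.lt_top⟩
  let g : (ι → X) × X × X → F := fun q => φ q.1 - φ (q.1 + Pi.single i (q.2.1 - q.2.2))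
  have hsingle : Measurable fun c : X × X => (Pi.single i (c.1 - c.2) : ι → X) :=
    (measurable_update 0).comp (measurable_fst.sub measurable_snd)
  have hg : AEStronglyMeasurable g
      ((Measure.pi fun _ : ι => μ).prod ((μ.prod μ).restrict (B ×ˢ B))) :=
    hφ.comp_fst.sub <| hφ.comp_quasiMeasurePreserving (quasiMeasurePreserving_add_comp hsingle)
  have hcomp : (fun p : (ι → X) × X × X => φ p.1 - φ (exchange i p).1) = g ∘ windowShear i := by
    funext p
    rw [exchange_fst_eq_add_single]
    rfl
  rw [hcomp, eLpNorm_comp_measurePreserving hg (measurePreserving_windowShear_windowMeasure hB i),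
    sq (μ.real B), ← measureReal_prod_prod, ← measureReal_restrict_apply_univ]
  refine toReal_eLpNorm_two_prod_sq_le hg ?_
  filter_upwards [ae_restrict_mem (hB.prod hB)] with c hc using hD c.1 hc.1 c.2 hc.2

variable [InnerProductSpace ℝ F]

theorem two_mul_sq_le_integral_inner_windowed (hL : MemLp φ 2 (Measure.pi fun _ : ι => μ))
    (hsupp : ∀ x, (∃ i, x i ∉ Λ) → φ x = 0) (hB : MeasurableSet B) (hB' : μ B ≠ ⊤) (i : ι) {D : ℝ}
    (hD : ∀ b ∈ B, ∀ b' ∈ B, translationModulus 2 (Measure.pi fun _ : ι => μ) φ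
      (Pi.single i (b - b')) ≤ ENNReal.ofReal D) :
    2 * (μ.real B ^ 2 * (eLpNorm φ 2 (Measure.pi fun _ : ι => μ)).toReal ^ 2) ≤
      2 * ∫ p, inner ℝ (windowed (slidingWindow Λ B) φ p)
          (windowed (slidingWindow Λ B) φ (exchange i p))
          ∂(Measure.pi fun _ : ι => μ).prod (μ.prod μ) +
        μ.real B ^ 2 * D ^ 2 := by
  have hmeas : MeasurableSet (windowShear i ⁻¹' (Set.univ ×ˢ (B ×ˢ B)) : Set ((ι → X) × X × X)) :=
    (measurePreserving_windowShear (μ := μ) i).measurable (MeasurableSet.univ.prod (hB.prod hB))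
  have hinner : ∫ p, inner ℝ (φ p.1) (φ (exchange i p).1) ∂windowMeasure μ B i =
      ∫ p, inner ℝ (windowed (slidingWindow Λ B) φ p)
        (windowed (slidingWindow Λ B) φ (exchange i p))
        ∂(Measure.pi fun _ : ι => μ).prod (μ.prod μ) := by
    rw [windowMeasure, ← integral_indicator hmeas]
    exact integral_congr_ae <| .of_forall fun p =>
      (inner_windowed_slidingWindow_exchange hsupp i p).symm
  have hpolar := two_mul_eLpNorm_sq_eq_of_measurePreserving
    (measurePreserving_exchange_windowMeasure hB i) (memLp_fst_windowMeasure hL hB hB' i)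
  rw [toReal_eLpNorm_fst_windowMeasure_sq hL.1 hB, hinner] at hpolar
  exact hpolar.trans_le <|
    add_le_add_right (toReal_eLpNorm_sub_exchange_windowMeasure_sq_le hL.1 hB hB' i hD) _

theorem exclusion_principle (hL : MemLp φ 2 (Measure.pi fun _ : ι => μ))
    (hφ : IsAlternating μ φ) (hsupp : ∀ x, (∃ i, x i ∉ Λ) → φ x = 0) (hΛ : MeasurableSet Λ)
    (hΛ' : μ Λ ≠ ⊤) (hB : MeasurableSet B) (hB' : μ B ≠ ⊤) {D : ι → ℝ}
    (hD : ∀ i, ∀ b ∈ B, ∀ b' ∈ B, translationModulus 2 (Measure.pi fun _ : ι => μ) φ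
      (Pi.single i (b - b')) ≤ ENNReal.ofReal (D i)) :
    2 * Fintype.card ι * μ.real B * (eLpNorm φ 2 (Measure.pi fun _ : ι => μ)).toReal ^ 2 ≤
      2 * μ.real Λ * (eLpNorm φ 2 (Measure.pi fun _ : ι => μ)).toReal ^ 2 +
        μ.real B * ∑ i, D i ^ 2 := by
  set N := (eLpNorm φ 2 (Measure.pi fun _ : ι => μ)).toReal
  have hwindow := measure_slidingWindow μ hΛ hB
  have hpauli := sum_integral_inner_windowed_le hL hφ (measurableSet_slidingWindow hΛ hB)
    (hwindow ▸ ENNReal.mul_ne_top hΛ' hB')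
  rw [measureReal_def, hwindow, ENNReal.toReal_mul, ← measureReal_def, ← measureReal_def] at hpauli
  have hsum := Finset.sum_le_sum fun i (_ : i ∈ Finset.univ) =>
    two_mul_sq_le_integral_inner_windowed hL hsupp hB hB' i (hD i)
  simp only [Finset.sum_const, Finset.card_univ, nsmul_eq_mul, Finset.sum_add_distrib,
    ← Finset.mul_sum] at hsum
  rcases (measureReal_nonneg (μ := μ) (s := B)).eq_or_lt with h0 | hpos
  · rw [← h0]
    have : 0 ≤ μ.real Λ * N ^ 2 := by positivity
    linarith
  · refine le_of_mul_le_mul_left ?_ hpos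
    linarith

end

/-! ## Translations of functions -/

section

variable {G F : Type*} [MeasurableSpace G] [NormedAddCommGroup F] {p : ENNReal} {μ : Measure G}
  {φ ψ : G → F}

theorem translationModulus_zero [AddZeroClass G] (φ : G → F) : translationModulus p μ φ 0 = 0 := by
  simp [translationModulus]

variable [AddGroup G] [MeasurableAdd G] [μ.IsAddRightInvariant]

theorem translationModulus_congr_ae (h : φ =ᵐ[μ] ψ) (v : G) :
    translationModulus p μ φ v = translationModulus p μ ψ v :=
  eLpNorm_congr_ae <| h.sub <|
    (measurePreserving_add_right μ v).quasiMeasurePreserving.ae_eq_comp h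

theorem aestronglyMeasurable_sub_add (hφ : AEStronglyMeasurable φ μ) (v : G) :
    AEStronglyMeasurable (fun x => φ x - φ (x + v)) μ :=
  hφ.sub (hφ.comp_measurePreserving (measurePreserving_add_right μ v))

theorem translationModulus_add_le (hp : 1 ≤ p) (hφ : AEStronglyMeasurable φ μ) (v w : G) :
    translationModulus p μ φ (v + w) ≤ translationModulus p μ φ v + translationModulus p μ φ w := by
  have hv := measurePreserving_add_right μ v
  have hφw := aestronglyMeasurable_sub_add hφ w
  have hsplit : (fun x => φ x - φ (x + (v + w))) =
      (fun x => φ x - φ (x + v)) + (fun x => φ x - φ (x + w)) ∘ (· + v) := by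
    funext x
    simp [add_assoc]
  rw [translationModulus, hsplit, translationModulus, translationModulus,
    ← eLpNorm_comp_measurePreserving hφw hv]
  exact eLpNorm_add_le (aestronglyMeasurable_sub_add hφ v) (hφw.comp_measurePreserving hv) hp

theorem translationModulus_neg (hφ : AEStronglyMeasurable φ μ) (v : G) :
    translationModulus p μ φ (-v) = translationModulus p μ φ v := by
  rw [translationModulus, translationModulus, ← eLpNorm_comp_measurePreserving
    (aestronglyMeasurable_sub_add hφ v) (measurePreserving_add_right μ (-v)), ← eLpNorm_neg]
  congr 1
  funext x
  simp

theorem translationModulus_nsmul_le (hp : 1 ≤ p) (hφ : AEStronglyMeasurable φ μ) (v : G) (m : ℕ) :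
    translationModulus p μ φ (m • v) ≤ m * translationModulus p μ φ v := by
  induction m with
  | zero => simp [translationModulus_zero]
  | succ m ih =>
    rw [succ_nsmul, Nat.cast_succ, add_mul, one_mul]
    exact (translationModulus_add_le hp hφ _ _).trans (by gcongr)

theorem translationModulus_zsmul_le (hp : 1 ≤ p) (hφ : AEStronglyMeasurable φ μ) (v : G) (m : ℤ) :
    translationModulus p μ φ (m • v) ≤ m.natAbs * translationModulus p μ φ v := by
  have hle := translationModulus_nsmul_le hp hφ v m.natAbs
  obtain ⟨k, rfl | rfl⟩ := m.eq_nat_or_neg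
  · simpa using hle
  · simpa [translationModulus_neg hφ] using hle

theorem translationModulus_le_add_eLpNorm_sub (hp : 1 ≤ p) (hφ : AEStronglyMeasurable φ μ)
    (hψ : AEStronglyMeasurable ψ μ) (v : G) :
    translationModulus p μ φ v ≤ translationModulus p μ ψ v + 2 * eLpNorm (φ - ψ) p μ := by
  have hv := measurePreserving_add_right μ v
  have hsub := hφ.sub hψ
  have hsplit : (fun x => φ x - φ (x + v)) =
      (fun x => ψ x - ψ (x + v)) + ((φ - ψ) - (φ - ψ) ∘ (· + v)) := by
    funext x
    simp only [Pi.add_apply, Pi.sub_apply, Function.comp_apply]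
    abel
  calc translationModulus p μ φ v
      ≤ translationModulus p μ ψ v + (eLpNorm (φ - ψ) p μ + eLpNorm ((φ - ψ) ∘ (· + v)) p μ) := by
        rw [translationModulus, hsplit]
        exact (eLpNorm_add_le (aestronglyMeasurable_sub_add hψ v)
          (hsub.sub (hsub.comp_measurePreserving hv)) hp).trans
          (add_le_add_right (eLpNorm_sub_le hsub (hsub.comp_measurePreserving hv) hp) _)
    _ = _ := by rw [eLpNorm_comp_measurePreserving hsub hv, two_mul]

end

section

variable {G F : Type*} [MeasurableSpace G] [AddCommGroup G] [MeasurableAdd G]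
  [NormedAddCommGroup F] {p : ENNReal} {μ : Measure G} [μ.IsAddRightInvariant] {φ : G → F}

theorem translationModulus_sum_le (hp : 1 ≤ p) (hφ : AEStronglyMeasurable φ μ) {κ : Type*}
    (s : Finset κ) (v : κ → G) :
    translationModulus p μ φ (∑ j ∈ s, v j) ≤ ∑ j ∈ s, translationModulus p μ φ (v j) :=
  Finset.le_sum_of_subadditive _ (translationModulus_zero φ).le
    (translationModulus_add_le hp hφ) s v

end

section

variable {E F : Type*} [NormedAddCommGroup E] [NormedSpace ℝ E]
  [NormedAddCommGroup F] [NormedSpace ℝ F] [CompleteSpace F] {g : E → F}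

theorem enorm_sub_add_sq_le_lintegral (hg : ContDiff ℝ 1 g) (x v : E) :
    ‖g x - g (x + v)‖ₑ ^ 2 ≤
      ∫⁻ t in Set.Ioc (0 : ℝ) 1, ‖fderiv ℝ g (x + t • v) v‖ₑ ^ 2 := by
  have : IsProbabilityMeasure (volume.restrict (Set.Ioc (0 : ℝ) 1)) := ⟨by simp⟩
  have hcont : Continuous fun t : ℝ => fderiv ℝ g (x + t • v) v :=
    ((hg.continuous_fderiv one_ne_zero).clm_apply continuous_const).comp (by fun_prop)
  have hderiv (t : ℝ) : HasDerivAt (fun t : ℝ => g (x + t • v)) (fderiv ℝ g (x + t • v) v) t := by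
    have hline : HasDerivAt (fun t : ℝ => x + t • v) v t := by
      simpa using ((hasDerivAt_id t).smul_const v).const_add x
    exact (hg.differentiable one_ne_zero (x + t • v)).hasFDerivAt.comp_hasDerivAt t hline
  have hftc := intervalIntegral.integral_eq_sub_of_hasDerivAt (a := 0) (b := 1)
    (fun t _ => hderiv t) (hcont.intervalIntegrable _ _)
  simp only [zero_smul, add_zero, one_smul, intervalIntegral.integral_of_le zero_le_one] at hftc
  rw [← eLpNorm_two_sq_eq_lintegral, ← enorm_neg, neg_sub, ← hftc]
  gcongr
  calc _ ≤ eLpNorm (fun t : ℝ => fderiv ℝ g (x + t • v) v) 1 (volume.restrict (Set.Ioc 0 1)) := by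
        rw [eLpNorm_one_eq_lintegral_enorm]
        exact enorm_integral_le_lintegral_enorm _
    _ ≤ _ := eLpNorm_le_eLpNorm_of_exponent_le one_le_two hcont.aestronglyMeasurable

theorem translationModulus_two_le_eLpNorm_fderiv [MeasurableSpace E] [BorelSpace E]
    [SecondCountableTopology E] {μ : Measure E} [SFinite μ] [μ.IsAddRightInvariant]
    (hg : ContDiff ℝ 1 g) (v : E) :
    translationModulus 2 μ g v ≤ eLpNorm (fun x => fderiv ℝ g x v) 2 μ := by
  have hmeas : Measurable fun q : E × ℝ => ‖fderiv ℝ g (q.1 + q.2 • v) v‖ₑ ^ 2 := by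
    have : Continuous fun q : E × ℝ => fderiv ℝ g (q.1 + q.2 • v) v :=
      ((hg.continuous_fderiv one_ne_zero).clm_apply continuous_const).comp (by fun_prop)
    exact this.enorm.measurable.pow_const 2
  rw [← ENNReal.pow_le_pow_left_iff two_ne_zero, translationModulus, eLpNorm_two_sq_eq_lintegral,
    eLpNorm_two_sq_eq_lintegral]
  calc ∫⁻ x, ‖g x - g (x + v)‖ₑ ^ 2 ∂μ
      ≤ ∫⁻ x, (∫⁻ t in Set.Ioc (0 : ℝ) 1, ‖fderiv ℝ g (x + t • v) v‖ₑ ^ 2) ∂μ :=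
        lintegral_mono fun x => enorm_sub_add_sq_le_lintegral hg x v
    _ = ∫⁻ t in Set.Ioc (0 : ℝ) 1, ∫⁻ x, ‖fderiv ℝ g (x + t • v) v‖ₑ ^ 2 ∂μ :=
        lintegral_lintegral_swap hmeas.aemeasurable
    _ = ∫⁻ x, ‖fderiv ℝ g x v‖ₑ ^ 2 ∂μ := by
        simp [lintegral_add_right_eq_self (fun x => ‖fderiv ℝ g x v‖ₑ ^ 2)]

end

/-- The constant in the lower bound on the energy per particle, the value of
`(d * l ^ 2)⁻¹ * (|Λ| / n) ^ (2 / d)` for a cube of side `l = 2 * (2 * |Λ| / n) ^ (1 / d)`. The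
leading factor `2` leaves room for rounding the side up to an integer in the lattice model. -/
noncomputable def energyConst (d : ℕ) : ℝ :=
  1 / (4 * d) * (1 / 2) ^ (2 / (d : ℝ))

theorem energyConst_pos {d : ℕ} (hd : 0 < d) : 0 < energyConst d := by
  unfold energyConst
  positivity

theorem energyConst_mul_rpow_mul_sq_le_one {d : ℕ} (hd : 0 < d) {n v l : ℝ} (hn : 0 < n)
    (hv : 0 < v) (hl : 0 ≤ l) (hle : l ^ d ≤ 2 ^ d * (2 * v / n)) :
    energyConst d * (n / v) ^ (2 / (d : ℝ)) * (l ^ 2 * d) ≤ 1 := by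
  have hd' : (d : ℝ) ≠ 0 := by positivity
  have hbase : 1 / 2 * (n / v) = (2 * v / n)⁻¹ := by field_simp
  have hsq : (l / 2) ^ 2 ≤ (2 * v / n) ^ (2 / (d : ℝ)) :=
    calc (l / 2) ^ 2 = ((l / 2) ^ d) ^ (2 / (d : ℝ)) := by
          rw [← Real.rpow_natCast_mul (by positivity), mul_div_cancel₀ _ hd', Real.rpow_two]
      _ ≤ (2 * v / n) ^ (2 / (d : ℝ)) := by
          gcongr
          rwa [div_pow, div_le_iff₀' (by positivity)]
  calc energyConst d * (n / v) ^ (2 / (d : ℝ)) * (l ^ 2 * d)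
      = ((2 * v / n) ^ (2 / (d : ℝ)))⁻¹ * (l / 2) ^ 2 := by
        rw [energyConst, mul_assoc (1 / (4 * (d : ℝ))), ← Real.mul_rpow (by positivity)
          (by positivity), hbase, Real.inv_rpow (by positivity)]
        field_simp
        norm_num
    _ ≤ 1 := by
        rw [inv_mul_le_iff₀ (by positivity), mul_one]
        exact hsq

theorem energyConst_mul_rpow_mul_le {d : ℕ} (hd : 0 < d) {n v l q T : ℝ} (hn : 0 < n) (hv : 0 < v)
    (hl : 0 ≤ l) (hT : 0 ≤ T) (hge : 2 * v / n ≤ l ^ d) (hle : l ^ d ≤ 2 ^ d * (2 * v / n))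
    (hq : 0 ≤ q) (h : 2 * n * l ^ d * q ≤ 2 * v * q + l ^ d * (l ^ 2 * d * T)) :
    energyConst d * (n / v) ^ (2 / (d : ℝ)) * n * q ≤ T := by
  have hld : 0 < l ^ d := (by positivity : 0 < 2 * v / n).trans_le hge
  have hnq : n * q ≤ l ^ 2 * d * T := by
    have : 2 * v * q ≤ n * l ^ d * q := by
      rw [div_le_iff₀' hn] at hge
      gcongr
    exact le_of_mul_le_mul_left (by linarith) hld
  have hconst := (energyConst_pos hd).le
  calc energyConst d * (n / v) ^ (2 / (d : ℝ)) * n * q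
      = energyConst d * (n / v) ^ (2 / (d : ℝ)) * (n * q) := mul_assoc _ _ _
    _ ≤ energyConst d * (n / v) ^ (2 / (d : ℝ)) * (l ^ 2 * d * T) := by gcongr
    _ = energyConst d * (n / v) ^ (2 / (d : ℝ)) * (l ^ 2 * d) * T := by ring
    _ ≤ 1 * T := by
        gcongr
        exact energyConst_mul_rpow_mul_sq_le_one hd hn hv hl hle
    _ = T := one_mul T

section

variable {ι κ X F : Type*} [Fintype ι] [DecidableEq ι] [Fintype κ] [AddCommGroup X]
  [MeasurableSpace X] [MeasurableAdd₂ X] [MeasurableSub₂ X] [NormedAddCommGroup F]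
  [InnerProductSpace ℝ F] {μ : Measure X} [SigmaFinite μ] [μ.IsAddLeftInvariant]
  {φ : (ι → X) → F} {Λ B : Set X}

theorem exclusion_principle_of_coordinates (hL : MemLp φ 2 (Measure.pi fun _ : ι => μ))
    (hφ : IsAlternating μ φ) (hsupp : ∀ x, (∃ i, x i ∉ Λ) → φ x = 0) (hΛ : MeasurableSet Λ)
    (hΛ' : μ Λ ≠ ⊤) (hB : MeasurableSet B) (hB' : μ B ≠ ⊤) {c : κ → X → ℝ} {l : ℝ}
    (hc : ∀ b ∈ B, ∀ b' ∈ B, ∀ j, |c j (b - b')| ≤ l) {a : ι → κ → ℝ}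
    (ha : ∀ i h, translationModulus 2 (Measure.pi fun _ : ι => μ) φ (Pi.single i h) ≤
      ENNReal.ofReal (∑ j, |c j h| * a i j)) :
    2 * Fintype.card ι * μ.real B * (eLpNorm φ 2 (Measure.pi fun _ : ι => μ)).toReal ^ 2 ≤
      2 * μ.real Λ * (eLpNorm φ 2 (Measure.pi fun _ : ι => μ)).toReal ^ 2 +
        μ.real B * (l ^ 2 * Fintype.card κ * ∑ i, ∑ j, a i j ^ 2) := by
  have hcs (i : ι) {b b' : X} (hb : b ∈ B) (hb' : b' ∈ B) :
      (∑ j, |c j (b - b')| * a i j) ^ 2 ≤ l ^ 2 * Fintype.card κ * ∑ j, a i j ^ 2 :=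
    calc (∑ j, |c j (b - b')| * a i j) ^ 2
        ≤ (∑ j, |c j (b - b')| ^ 2) * ∑ j, a i j ^ 2 := Finset.sum_mul_sq_le_sq_mul_sq _ _ _
      _ ≤ (∑ _j : κ, l ^ 2) * ∑ j, a i j ^ 2 := by
          gcongr with j
          exact hc b hb b' hb' j
      _ = _ := by rw [Finset.sum_const, Finset.card_univ, nsmul_eq_mul, mul_comm (l ^ 2)]
  have hmain := exclusion_principle hL hφ hsupp hΛ hΛ' hB hB'
    (D := fun i => √(l ^ 2 * Fintype.card κ * ∑ j, a i j ^ 2)) fun i b hb b' hb' =>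
      (ha i _).trans <| ENNReal.ofReal_le_ofReal <| Real.le_sqrt_of_sq_le (hcs i hb hb')
  simp only [Real.sq_sqrt (show 0 ≤ l ^ 2 * Fintype.card κ * ∑ j, a _ j ^ 2 by positivity),
    ← Finset.mul_sum] at hmain
  exact hmain

end

/-! ## The continuum model -/

/-- The product of the sets `s j` of coordinates, as a set of points of Euclidean space. -/
def coordinateBox {d : ℕ} (s : Fin d → Set ℝ) : Set (Space d) :=
  {x | ∀ j, x j ∈ s j}

section

variable {d : ℕ} {s : Fin d → Set ℝ}

theorem coordinateBox_eq_preimage (s : Fin d → Set ℝ) :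
    coordinateBox s = WithLp.ofLp ⁻¹' Set.univ.pi s := by
  ext x
  simp [coordinateBox]

theorem measurableSet_coordinateBox (hs : ∀ j, MeasurableSet (s j)) :
    MeasurableSet (coordinateBox s) := by
  rw [coordinateBox_eq_preimage]
  exact (PiLp.volume_preserving_ofLp (Fin d)).measurable (MeasurableSet.univ_pi hs)

theorem volume_coordinateBox (hs : ∀ j, MeasurableSet (s j)) :
    volume (coordinateBox s) = ∏ j, volume (s j) := by
  rw [coordinateBox_eq_preimage, (PiLp.volume_preserving_ofLp (Fin d)).measure_preimage
    (MeasurableSet.univ_pi hs).nullMeasurableSet, volume_pi_pi]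

end

section

variable {d n : ℕ} {Λ : Domain d}

theorem measurableSet_boxPow (Λ : Domain d) (n : ℕ) : MeasurableSet (boxPow Λ n) :=
  MeasurableSet.univ_pi fun _ => Λ.isOpen.measurableSet

/-- Extension by zero of a wave function on `Λ ^ n`. -/
noncomputable def extend (φ : L2 Λ n) : Config d n → ℂ :=
  (boxPow Λ n).indicator φ

theorem eLpNorm_extend (φ : L2 Λ n) : eLpNorm (extend φ) 2 volume = ‖φ‖ₑ := by
  rw [extend, eLpNorm_indicator_eq_eLpNorm_restrict (measurableSet_boxPow Λ n), Lp.enorm_def]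
  rfl

theorem memLp_extend (φ : L2 Λ n) : MemLp (extend φ) 2 volume :=
  (memLp_indicator_iff_restrict (measurableSet_boxPow Λ n)).2 (Lp.memLp φ)

theorem extend_sub (φ ψ : L2 Λ n) : extend (φ - ψ) =ᵐ[volume] extend φ - extend ψ := by
  have hsub := (ae_restrict_iff' (measurableSet_boxPow Λ n)).1 (Lp.coeFn_sub φ ψ)
  filter_upwards [hsub] with x hx
  by_cases hxΛ : x ∈ boxPow Λ n
  · simpa only [extend, Set.indicator_of_mem hxΛ, Pi.sub_apply] using hx hxΛ
  · simp [extend, hxΛ]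

theorem extend_congr_of_support_subset {φ : L2 Λ n} {g : Config d n → ℂ}
    (hg : Function.support g ⊆ boxPow Λ n) (hφ : φ =ᵐ[boxMeasure Λ n] g) :
    extend φ =ᵐ[volume] g := by
  filter_upwards [(ae_restrict_iff' (measurableSet_boxPow Λ n)).1 hφ] with x hx
  by_cases hxΛ : x ∈ boxPow Λ n
  · rw [extend, Set.indicator_of_mem hxΛ, hx hxΛ]
  · rw [extend, Set.indicator_of_notMem hxΛ, Function.notMem_support.1 fun h => hxΛ (hg h)]

theorem isAlternating_extend {φ : L2 Λ n} (hφ : IsAntisymmetric φ) :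
    IsAlternating volume (extend φ) := by
  intro i j hij
  filter_upwards [(ae_restrict_iff' (measurableSet_boxPow Λ n)).1 (hφ (Equiv.swap i j))] with x hx
  have hmem : x ∘ Equiv.swap i j ∈ boxPow Λ n ↔ x ∈ boxPow Λ n := by
    simp only [boxPow, Set.mem_univ_pi, Function.comp_apply]
    exact (Equiv.swap i j).forall_congr_right (q := fun k => x k ∈ Λ.carrier)
  by_cases hxΛ : x ∈ boxPow Λ n
  · rw [extend, Set.indicator_of_mem hxΛ, Set.indicator_of_mem (hmem.2 hxΛ)]
    have hsign := hx hxΛ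
    rwa [Equiv.Perm.sign_swap hij, Units.val_neg, Units.val_one, Int.cast_neg, Int.cast_one,
      neg_one_mul] at hsign
  · rw [extend, Set.indicator_of_notMem hxΛ, Set.indicator_of_notMem (mt hmem.1 hxΛ), neg_zero]

theorem continuous_translationModulus_extend (v : Config d n) :
    Continuous fun φ : L2 Λ n => translationModulus 2 volume (extend φ) v := by
  refine continuous_of_le_add_edist 2 (by simp) fun φ ψ => ?_
  rw [edist_eq_enorm_sub, ← eLpNorm_extend, eLpNorm_congr_ae (extend_sub φ ψ)]
  exact translationModulus_le_add_eLpNorm_sub one_le_two (memLp_extend φ).1 (memLp_extend ψ).1 v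

theorem fderiv_single_eq_sum (g : Config d n → ℂ) (x : Config d n) (i : Fin n) (h : Space d) :
    fderiv ℝ g x (Pi.single i h) =
      ∑ j, h j • fderiv ℝ g x (Pi.single i (EuclideanSpace.single j 1)) := by
  have hbasis : h = ∑ j, h j • EuclideanSpace.single j (1 : ℝ) := by
    simpa using ((EuclideanSpace.basisFun (Fin d) ℝ).sum_repr h).symm
  have hsingle : Pi.single i h =
      ∑ j, h j • (Pi.single i (EuclideanSpace.single j 1) : Config d n) := by
    simpa using congrArg (LinearMap.single ℝ (fun _ : Fin n => Space d) i) hbasis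
  simp only [hsingle, map_sum, map_smul]

theorem eLpNorm_fderiv_eq_enorm {g : Config d n → ℂ} (hsupp : tsupport g ⊆ boxPow Λ n)
    (v : Config d n) {w : L2 Λ n} (hw : w =ᵐ[boxMeasure Λ n] fun x => fderiv ℝ g x v) :
    eLpNorm (fun x => fderiv ℝ g x v) 2 volume = ‖w‖ₑ := by
  have hsub : (fun x => fderiv ℝ g x v).support ⊆ boxPow Λ n := fun x hx =>
    hsupp <| support_fderiv_subset ℝ fun h => hx <| by simp [h]
  rw [← eLpNorm_restrict_eq_of_support_subset hsub, Lp.enorm_def]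
  exact (eLpNorm_congr_ae hw).symm

theorem translationModulus_extend_le_of_mem_testGraph {φ : L2 Λ n} {u : Fin n → Fin d → L2 Λ n}
    (hφ : (φ, u) ∈ testGraph Λ n) (i : Fin n) (h : Space d) :
    translationModulus 2 volume (extend φ) (Pi.single i h) ≤
      ENNReal.ofReal (∑ j, |h j| * ‖u i j‖) := by
  obtain ⟨g, hg, -, hsupp, hφg, hu⟩ := hφ
  have hg1 : ContDiff ℝ 1 g := hg.of_le (by exact_mod_cast le_top)
  have hcont (v : Config d n) : Continuous fun x => fderiv ℝ g x v :=
    (hg1.continuous_fderiv one_ne_zero).clm_apply continuous_const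
  rw [translationModulus_congr_ae
    (extend_congr_of_support_subset ((subset_tsupport g).trans hsupp) hφg)]
  calc translationModulus 2 volume g (Pi.single i h)
      ≤ eLpNorm (fun x => fderiv ℝ g x (Pi.single i h)) 2 volume :=
        translationModulus_two_le_eLpNorm_fderiv hg1 _
    _ = eLpNorm (∑ j, h j • fun x => fderiv ℝ g x (Pi.single i (EuclideanSpace.single j 1))) 2
          volume := by
        congr 1
        funext x
        rw [fderiv_single_eq_sum, Finset.sum_apply]
        rfl
    _ ≤ ∑ j, eLpNorm (h j • fun x => fderiv ℝ g x (Pi.single i (EuclideanSpace.single j 1))) 2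
          volume :=
        eLpNorm_sum_le (fun j _ => (hcont _).aestronglyMeasurable.const_smul (h j)) one_le_two
    _ = ENNReal.ofReal (∑ j, |h j| * ‖u i j‖) := by
        rw [ENNReal.ofReal_sum_of_nonneg fun j _ => by positivity]
        refine Finset.sum_congr rfl fun j _ => ?_
        rw [eLpNorm_const_smul, eLpNorm_fderiv_eq_enorm hsupp _ (hu i j),
          ENNReal.ofReal_mul (abs_nonneg _), Real.enorm_eq_ofReal_abs, ofReal_norm]

theorem isClosed_setOf_translationModulus_extend_le (Λ : Domain d) (i : Fin n) (h : Space d) :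
    IsClosed {q : L2 Λ n × (Fin n → Fin d → L2 Λ n) |
      translationModulus 2 volume (extend q.1) (Pi.single i h) ≤
        ENNReal.ofReal (∑ j, |h j| * ‖q.2 i j‖)} :=
  isClosed_le ((continuous_translationModulus_extend _).comp continuous_fst)
    (ENNReal.continuous_ofReal.comp (by fun_prop))

theorem HasDirichletGradient.mem_of_isClosed {φ : L2 Λ n} {u : Fin n → Fin d → L2 Λ n}
    (hu : HasDirichletGradient φ u) {S : Set (L2 Λ n × (Fin n → Fin d → L2 Λ n))}
    (hS : IsClosed S) (hsub : testGraph Λ n ⊆ S) : (φ, u) ∈ S :=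
  closure_minimal hsub hS hu

theorem translationModulus_extend_le {φ : L2 Λ n} {u : Fin n → Fin d → L2 Λ n}
    (hu : HasDirichletGradient φ u) (i : Fin n) (h : Space d) :
    translationModulus 2 volume (extend φ) (Pi.single i h) ≤
      ENNReal.ofReal (∑ j, |h j| * ‖u i j‖) :=
  hu.mem_of_isClosed (isClosed_setOf_translationModulus_extend_le Λ i h)
    fun _ hq => translationModulus_extend_le_of_mem_testGraph hq i h

theorem kinetic_energy_ge (hd : 0 < d) {φ : L2 Λ n} {u : Fin n → Fin d → L2 Λ n}
    (hφ : IsAntisymmetric φ) (hu : HasDirichletGradient φ u) (hn : 0 < n)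
    (hΛ : 0 < (volume Λ.carrier).toReal) :
    energyConst d * (n / (volume Λ.carrier).toReal) ^ (2 / (d : ℝ)) * n * ‖φ‖ ^ 2 ≤
      ∑ i, ∑ j, ‖u i j‖ ^ 2 := by
  have hn' : (0 : ℝ) < n := Nat.cast_pos.2 hn
  set l : ℝ := (2 * (volume Λ.carrier).toReal / n) ^ (d : ℝ)⁻¹
  have hl : 0 ≤ l := by positivity
  have hld : l ^ d = 2 * (volume Λ.carrier).toReal / n :=
    Real.rpow_inv_natCast_pow (by positivity) hd.ne'
  have hB : volume (coordinateBox fun _ : Fin d => Set.Ico 0 l) = ENNReal.ofReal (l ^ d) := by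
    rw [volume_coordinateBox fun _ => measurableSet_Ico]
    simp [ENNReal.ofReal_pow hl]
  have hscale := exclusion_principle_of_coordinates (memLp_extend φ) (isAlternating_extend hφ)
    (fun x ⟨i, hi⟩ => Set.indicator_of_notMem (fun hx : x ∈ boxPow Λ n => hi (hx i trivial)) _)
    Λ.isOpen.measurableSet Λ.isBounded.measure_lt_top.ne
    (measurableSet_coordinateBox fun _ => measurableSet_Ico) (hB ▸ ENNReal.ofReal_ne_top)
    (c := fun j x => x j) (fun b hb b' hb' j =>
      (abs_sub_lt_of_nonneg_of_lt (hb j).1 (hb j).2 (hb' j).1 (hb' j).2).le)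
    (translationModulus_extend_le hu)
  rw [← volume_pi, eLpNorm_extend, toReal_enorm, measureReal_def, hB,
    ENNReal.toReal_ofReal (by positivity), measureReal_def, Fintype.card_fin, Fintype.card_fin]
    at hscale
  refine energyConst_mul_rpow_mul_le hd hn' hΛ hl (by positivity) hld.ge ?_ (by positivity) hscale
  rw [hld]
  exact le_mul_of_one_le_left (by positivity) (one_le_pow₀ one_le_two)

theorem ae_sum_potential_nonneg {V : Space d → ℝ} (hV : ∀ᵐ x, 0 ≤ V x) (Λ : Domain d) (n : ℕ) :
    ∀ᵐ x ∂boxMeasure Λ n, 0 ≤ ∑ i, V (x i) := by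
  have hall : ∀ᵐ x : Config d n, ∀ i, 0 ≤ V (x i) := ae_all_iff.2 fun i =>
    (Measure.quasiMeasurePreserving_eval (fun _ : Fin n => (volume : Measure (Space d))) i).ae hV
  filter_upwards [ae_restrict_of_ae hall] with x hx using Finset.sum_nonneg fun i _ => hx i

theorem re_integral_potential_nonneg {V : Space d → ℝ} (hV : ∀ᵐ x, 0 ≤ V x) (φ : L2 Λ n) :
    0 ≤ (∫ x, ((∑ i, V (x i) : ℝ) : ℂ) * (conj (φ x) * φ x) ∂boxMeasure Λ n).re := by
  have hreal : ∫ x, ((∑ i, V (x i) : ℝ) : ℂ) * (conj (φ x) * φ x) ∂boxMeasure Λ n =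
      ((∫ x, (∑ i, V (x i)) * ‖φ x‖ ^ 2 ∂boxMeasure Λ n : ℝ) : ℂ) := by
    simp only [Complex.conj_mul', ← integral_complex_ofReal, Complex.ofReal_mul, Complex.ofReal_pow]
  rw [hreal, Complex.ofReal_re]
  refine integral_nonneg_of_ae ?_
  filter_upwards [ae_sum_potential_nonneg hV Λ n] with x hx using mul_nonneg hx (sq_nonneg _)

theorem kinetic_energy_le_re_inner {V : Space d → ℝ} (hV : ∀ᵐ x, 0 ≤ V x)
    {φ f : L2 Λ n} {u : Fin n → Fin d → L2 Λ n} (hu : InFormDomain V φ u)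
    (h : ∀ (ψ : L2 Λ n) (w : Fin n → Fin d → L2 Λ n), InFormDomain V ψ w →
      (∑ i, ∑ j, inner ℂ (u i j) (w i j)) +
        ∫ x, ((∑ i, V (x i) : ℝ) : ℂ) * (conj (φ x) * ψ x) ∂boxMeasure Λ n = inner ℂ f ψ) :
    ∑ i, ∑ j, ‖u i j‖ ^ 2 ≤ (inner ℂ f φ).re := by
  have hkin : (∑ i, ∑ j, inner ℂ (u i j) (u i j)).re = ∑ i, ∑ j, ‖u i j‖ ^ 2 := by
    simp only [Complex.re_sum]
    exact Finset.sum_congr rfl fun i _ => Finset.sum_congr rfl fun j _ =>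
      inner_self_eq_norm_sq (𝕜 := ℂ) (u i j)
  rw [← h φ u hu, Complex.add_re, hkin]
  exact le_add_of_nonneg_right (re_integral_potential_nonneg hV φ)

theorem le_groundEnergy_div (hd : 0 < d) {V : Space d → ℝ} (hV : ∀ᵐ x, 0 ≤ V x) (Λ : Domain d)
    (hn : 0 < n) (hΛ : 0 < (volume Λ.carrier).toReal) :
    ((energyConst d * (n / (volume Λ.carrier).toReal) ^ (2 / (d : ℝ)) : ℝ) : EReal) ≤
      groundEnergy V Λ n / ((n : ℝ) : EReal) := by
  rw [EReal.le_div_iff_mul_le (by exact_mod_cast hn) (EReal.coe_ne_top _), ← EReal.coe_mul]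
  refine le_iInf fun ⟨⟨φ, f⟩, ⟨_, u, hu, h⟩, hne⟩ => ?_
  rw [EReal.coe_le_coe_iff, le_div_iff₀ (pow_pos (norm_pos_iff.2 hne) 2)]
  exact (kinetic_energy_ge hd hu.1 hu.2.1 hn hΛ).trans (kinetic_energy_le_re_inner hV hu h)

end

/-! ## The lattice model -/

theorem pi_count {ι X : Type*} [Fintype ι] [Countable X] [MeasurableSpace X]
    [MeasurableSingletonClass X] :
    (Measure.pi fun _ : ι => (Measure.count : Measure X)) = Measure.count := by
  refine Measure.ext_of_singleton fun x => ?_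
  rw [Measure.pi_singleton]
  simp

theorem toReal_eLpNorm_two_count_sq {X F : Type*} [MeasurableSpace X] [MeasurableSingletonClass X]
    [NormedAddCommGroup F] (f : X → F) :
    (eLpNorm f 2 Measure.count).toReal ^ 2 = ∑' x, ‖f x‖ ^ 2 := by
  rw [← ENNReal.toReal_pow, eLpNorm_two_sq_eq_lintegral, lintegral_count,
    ENNReal.tsum_toReal_eq fun x => by simp]
  simp

theorem memLp_two_count_of_finite_support {X F : Type*} [Countable X] [MeasurableSpace X]
    [MeasurableSingletonClass X] [NormedAddCommGroup F] {f : X → F} (hf : f.support.Finite) :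
    MemLp f 2 Measure.count := by
  refine ⟨StronglyMeasurable.of_discrete.aestronglyMeasurable, ?_⟩
  have hsq : eLpNorm f 2 Measure.count ^ 2 < ⊤ := by
    rw [eLpNorm_two_sq_eq_lintegral, lintegral_count,
      tsum_eq_sum (s := hf.toFinset) fun x hx => by simpa using hx]
    exact ENNReal.sum_lt_top.2 fun x _ => ENNReal.pow_lt_top enorm_lt_top
  simpa using hsq

theorem exists_nat_le_pow_le {d : ℕ} (hd : d ≠ 0) {s : ℝ} (hs : 1 ≤ s) :
    ∃ l : ℕ, s ≤ (l : ℝ) ^ d ∧ (l : ℝ) ^ d ≤ 2 ^ d * s := by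
  have hs0 : 0 ≤ s := zero_le_one.trans hs
  set r : ℝ := s ^ (d : ℝ)⁻¹
  have hr : 1 ≤ r := Real.one_le_rpow hs (by positivity)
  have hrd : r ^ d = s := Real.rpow_inv_natCast_pow hs0 hd
  refine ⟨⌈r⌉₊, ?_, ?_⟩
  · rw [← hrd]
    gcongr
    exact Nat.le_ceil r
  · rw [← hrd, ← mul_pow]
    gcongr
    linarith [Nat.ceil_lt_add_one (zero_le_one.trans hr)]

theorem tsum_re_conj_laplacian_mul {E : Type*} [AddCommGroup E] {φ : E → ℂ}
    (hφ : φ.support.Finite) (v : E) :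
    ∑' x, (conj ((φ x - φ (x + v)) + (φ x - φ (x - v))) * φ x).re =
      ∑' x, ‖φ x - φ (x + v)‖ ^ 2 := by
  have hsum {ψ : E → ℂ} (hψ : ψ.support.Finite) (f : E → ℂ) :
      Summable fun x => (conj (f x) * ψ x).re :=
    summable_of_hasFiniteSupport (hψ.subset fun x hx h => hx (by simp [h]))
  have htranslate : (fun x => φ (x + v)).support.Finite :=
    hφ.preimage (f := fun x => x + v) (add_left_injective v).injOn
  have hshift : ∑' x, (conj (φ x - φ (x + v)) * φ (x + v)).re =
      ∑' x, (conj (φ (x - v) - φ x) * φ x).re := by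
    rw [← (Equiv.addRight v).tsum_eq fun x => (conj (φ (x - v) - φ x) * φ x).re]
    simp
  calc ∑' x, (conj ((φ x - φ (x + v)) + (φ x - φ (x - v))) * φ x).re
      = ∑' x, ((conj (φ x - φ (x + v)) * φ x).re - (conj (φ (x - v) - φ x) * φ x).re) := by
        refine tsum_congr fun x => ?_
        rw [← Complex.sub_re, ← sub_mul, ← map_sub]
        congr 4
        ring
    _ = ∑' x, ((conj (φ x - φ (x + v)) * φ x).re - (conj (φ x - φ (x + v)) * φ (x + v)).re) := by
        rw [(hsum hφ _).tsum_sub (hsum hφ _), ← hshift,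
          ← (hsum hφ _).tsum_sub (hsum htranslate _)]
    _ = ∑' x, ‖φ x - φ (x + v)‖ ^ 2 := by
        refine tsum_congr fun x => ?_
        rw [← Complex.sub_re, ← mul_sub, Complex.conj_mul']
        norm_cast

section

variable {d n : ℕ} {Λ : Finset (Lattice d)} {φ : (Fin n → Lattice d) → ℂ}

theorem pi_single_eq_sum_latticeStep (i : Fin n) (h : Lattice d) :
    Pi.single i h = ∑ j, h j • latticeStep i j := by
  conv_lhs => rw [pi_eq_sum_univ' h]
  exact map_sum (AddMonoidHom.single (fun _ : Fin n => Lattice d) i) _ _ |>.trans <|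
    Finset.sum_congr rfl fun j _ => map_zsmul (AddMonoidHom.single _ i) (h j) _

theorem translationModulus_single_le (hφ : MemLp φ 2 Measure.count) (i : Fin n) (h : Lattice d) :
    translationModulus 2 Measure.count φ (Pi.single i h) ≤ ENNReal.ofReal
      (∑ j, |(h j : ℝ)| * (translationModulus 2 Measure.count φ (latticeStep i j)).toReal) := by
  have hfin (v : Fin n → Lattice d) : translationModulus 2 Measure.count φ v ≠ ⊤ :=
    (hφ.sub (hφ.comp_measurePreserving (measurePreserving_add_right _ v))).2.ne
  rw [pi_single_eq_sum_latticeStep, ENNReal.ofReal_sum_of_nonneg fun j _ => by positivity]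
  refine (translationModulus_sum_le one_le_two hφ.1 _ _).trans (Finset.sum_le_sum fun j _ => ?_)
  refine (translationModulus_zsmul_le one_le_two hφ.1 _ _).trans_eq ?_
  rw [ENNReal.ofReal_mul (abs_nonneg _), ENNReal.ofReal_toReal (hfin _), ← Int.cast_abs,
    ← Nat.cast_natAbs, ENNReal.ofReal_natCast]

theorem eq_zero_of_notMem_piFinset (hφ : φ ∈ latticeFermions Λ n) {x : Fin n → Lattice d}
    (hx : x ∉ Fintype.piFinset fun _ : Fin n => Λ) : φ x = 0 :=
  hφ.1 x <| not_forall.1 <| mt Fintype.mem_piFinset.2 hx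

theorem finite_support_of_mem_latticeFermions (hφ : φ ∈ latticeFermions Λ n) :
    φ.support.Finite :=
  (Fintype.piFinset fun _ : Fin n => Λ).finite_toSet.subset fun _ hx =>
    by_contra fun hxΛ => hx (eq_zero_of_notMem_piFinset hφ hxΛ)

theorem comp_swap_of_mem_latticeFermions (hφ : φ ∈ latticeFermions Λ n) {i j : Fin n} (hij : i ≠ j)
    (x : Fin n → Lattice d) : φ (x ∘ Equiv.swap i j) = -φ x := by
  have hsign := hφ.2 (Equiv.swap i j) x
  rwa [Equiv.Perm.sign_swap hij, Units.val_neg, Units.val_one, Int.cast_neg, Int.cast_one,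
    neg_one_mul] at hsign

theorem card_le_of_mem_latticeFermions (hφ : φ ∈ latticeFermions Λ n) (hne : φ ≠ 0) :
    n ≤ Λ.card := by
  by_contra! hlt
  obtain ⟨x, hx⟩ := Function.ne_iff.1 hne
  have hmem : ∀ i ∈ (Finset.univ : Finset (Fin n)), x i ∈ Λ := fun i _ =>
    by_contra fun hi => hx (hφ.1 x ⟨i, hi⟩)
  obtain ⟨i, -, j, -, hij, heq⟩ := Finset.exists_ne_map_eq_of_card_lt_of_maps_to
    (by simpa using hlt) hmem
  have hswap : x ∘ Equiv.swap i j = x := by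
    rw [Equiv.comp_swap_eq_update, heq, Function.update_eq_self, ← heq, Function.update_eq_self]
  have hneg := comp_swap_of_mem_latticeFermions hφ hij x
  rw [hswap] at hneg
  exact hx (self_eq_neg.1 hneg)

theorem lattice_kinetic_energy_ge (hd : 0 < d) (hφ : φ ∈ latticeFermions Λ n) (hne : φ ≠ 0)
    (hn : 0 < n) :
    energyConst d * (n / (Λ.card : ℝ)) ^ (2 / (d : ℝ)) * n * ∑' x, ‖φ x‖ ^ 2 ≤
      ∑ i, ∑ j, ∑' x, ‖φ x - φ (x + latticeStep i j)‖ ^ 2 := by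
  have hn' : (0 : ℝ) < n := Nat.cast_pos.2 hn
  have hcard : (n : ℝ) ≤ Λ.card := Nat.cast_le.2 (card_le_of_mem_latticeFermions hφ hne)
  have hmem := memLp_two_count_of_finite_support (finite_support_of_mem_latticeFermions hφ)
  obtain ⟨l, hge, hle⟩ := exists_nat_le_pow_le hd.ne' (s := 2 * Λ.card / n)
    ((one_le_div hn').2 (by linarith))
  set B : Finset (Lattice d) := Fintype.piFinset fun _ => Finset.Ico (0 : ℤ) l
  have hB : Measure.count.real (B : Set (Lattice d)) = (l : ℝ) ^ d := by
    rw [measureReal_def, Measure.count_apply_finset, Fintype.card_piFinset]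
    simp
  have hdiff : ∀ b ∈ B, ∀ b' ∈ B, ∀ j, |((b - b') j : ℝ)| ≤ l := by
    intro b hb b' hb' j
    obtain ⟨hb₀, hb₁⟩ := Finset.mem_Ico.1 (Fintype.mem_piFinset.1 hb j)
    obtain ⟨hb₀', hb₁'⟩ := Finset.mem_Ico.1 (Fintype.mem_piFinset.1 hb' j)
    exact_mod_cast (abs_sub_lt_of_nonneg_of_lt hb₀ hb₁ hb₀' hb₁').le
  have hscale := exclusion_principle_of_coordinates (μ := Measure.count) (by rwa [pi_count])
    (fun i j hij => .of_forall (comp_swap_of_mem_latticeFermions hφ hij)) hφ.1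
    Λ.measurableSet (by simp) B.measurableSet (by simp) (c := fun j h => (h j : ℝ)) hdiff
    (a := fun i j => (translationModulus 2 Measure.count φ (latticeStep i j)).toReal)
    fun i h => by
      rw [pi_count]
      exact translationModulus_single_le hmem i h
  simp only [pi_count, translationModulus, toReal_eLpNorm_two_count_sq, hB, Fintype.card_fin]
    at hscale
  refine energyConst_mul_rpow_mul_le hd hn' (hn'.trans_le hcard) (Nat.cast_nonneg l)
    (by positivity) hge hle (by positivity) ?_
  simpa [measureReal_def, Measure.count_apply_finset] using hscale

theorem re_conj_latticeHamiltonian_mul (V : Lattice d → ℝ) (φ : (Fin n → Lattice d) → ℂ)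
    (x : Fin n → Lattice d) :
    (conj (latticeHamiltonian V φ x) * φ x).re =
      (∑ i, ∑ j, (conj ((φ x - φ (x + latticeStep i j)) +
        (φ x - φ (x - latticeStep i j))) * φ x).re) + ∑ i, V (x i) * ‖φ x‖ ^ 2 := by
  simp only [latticeHamiltonian, map_sum, Finset.sum_mul, Complex.re_sum]
  rw [← Finset.sum_add_distrib]
  refine Finset.sum_congr rfl fun i _ => ?_
  rw [map_add, add_mul, Complex.add_re, map_sum, Finset.sum_mul, Complex.re_sum, map_mul,
    Complex.conj_ofReal, mul_assoc, Complex.conj_mul']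
  norm_cast

theorem lattice_kinetic_energy_le_re {V : Lattice d → ℝ} (hV : ∀ x, 0 ≤ V x)
    (hφ : φ ∈ latticeFermions Λ n) :
    ∑ i, ∑ j, ∑' x, ‖φ x - φ (x + latticeStep i j)‖ ^ 2 ≤
      (∑ x ∈ Fintype.piFinset fun _ => Λ, conj (latticeHamiltonian V φ x) * φ x).re := by
  have hparts (i : Fin n) (j : Fin d) : ∑' x, ‖φ x - φ (x + latticeStep i j)‖ ^ 2 =
      ∑ x ∈ Fintype.piFinset fun _ : Fin n => Λ,
        (conj ((φ x - φ (x + latticeStep i j)) + (φ x - φ (x - latticeStep i j))) * φ x).re := by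
    rw [← tsum_re_conj_laplacian_mul (finite_support_of_mem_latticeFermions hφ),
      tsum_eq_sum fun x hx => by simp [eq_zero_of_notMem_piFinset hφ hx]]
  simp only [hparts, Complex.re_sum, Finset.sum_comm (t := Fintype.piFinset fun _ : Fin n => Λ)]
  refine Finset.sum_le_sum fun x _ => ?_
  rw [re_conj_latticeHamiltonian_mul]
  exact le_add_of_nonneg_right <|
    Finset.sum_nonneg fun i _ => mul_nonneg (hV (x i)) (sq_nonneg _)

theorem volume_cells (Λ : Finset (Lattice d)) : volume (cells Λ) = Λ.card := by
  have hmem (z : Lattice d) (x : Space d) :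
      x ∈ coordinateBox (fun j => Set.Ico (z j : ℝ) (z j + 1)) ↔ (fun j => ⌊x j⌋) = z := by
    simp only [funext_iff, Int.floor_eq_iff]
    rfl
  have hunion : cells Λ = ⋃ z ∈ Λ, coordinateBox fun j => Set.Ico (z j : ℝ) (z j + 1) := by
    ext x
    simp [hmem, cells]
  rw [hunion, measure_biUnion_finset]
  · simp [volume_coordinateBox fun _ => measurableSet_Ico]
  · exact fun z _ w _ hzw => Set.disjoint_left.2 fun x hz hw =>
      hzw (((hmem z x).1 hz).symm.trans ((hmem w x).1 hw))
  · exact fun z _ => measurableSet_coordinateBox fun _ => measurableSet_Ico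

theorem le_latticeGroundEnergy_div (hd : 0 < d) {V : Lattice d → ℝ} (hV : ∀ x, 0 ≤ V x)
    (Λ : Finset (Lattice d)) (hn : 0 < n) :
    ((energyConst d * (n / (volume (cells Λ)).toReal) ^ (2 / (d : ℝ)) : ℝ) : EReal) ≤
      latticeGroundEnergy V Λ n / ((n : ℝ) : EReal) := by
  rw [EReal.le_div_iff_mul_le (by exact_mod_cast hn) (EReal.coe_ne_top _), ← EReal.coe_mul,
    volume_cells, ENNReal.toReal_natCast]
  refine le_iInf fun ⟨φ, hφ, hne⟩ => ?_
  have hkin := lattice_kinetic_energy_ge hd hφ hne hn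
  rw [tsum_eq_sum (s := Fintype.piFinset fun _ => Λ) fun x hx => by
    simp [eq_zero_of_notMem_piFinset hφ hx]] at hkin
  obtain ⟨x, hx⟩ := Function.ne_iff.1 hne
  have hpos : 0 < ∑ x ∈ Fintype.piFinset fun _ : Fin n => Λ, ‖φ x‖ ^ 2 :=
    Finset.sum_pos' (fun _ _ => sq_nonneg _)
      ⟨x, by_contra fun h => hx (eq_zero_of_notMem_piFinset hφ h), pow_pos (norm_pos_iff.2 hx) 2⟩
  rw [EReal.coe_le_coe_iff, le_div_iff₀ hpos]
  exact hkin.trans (lattice_kinetic_energy_le_re hV hφ)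

end

/-! ## Energy densities -/

section

variable {d : ℕ} {s : Fin d → Set ℝ}

theorem isOpen_coordinateBox (hs : ∀ j, IsOpen (s j)) : IsOpen (coordinateBox s) := by
  rw [coordinateBox_eq_preimage]
  exact (isOpen_set_pi Set.finite_univ fun j _ => hs j).preimage (PiLp.continuous_ofLp 2 _)

theorem isClosed_coordinateBox (hs : ∀ j, IsClosed (s j)) : IsClosed (coordinateBox s) := by
  rw [coordinateBox_eq_preimage]
  exact (isClosed_set_pi fun j _ => hs j).preimage (PiLp.continuous_ofLp 2 _)

theorem isBounded_coordinateBox (hs : ∀ j, Bornology.IsBounded (s j)) :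
    Bornology.IsBounded (coordinateBox s) := by
  rw [coordinateBox_eq_preimage]
  exact (PiLp.antilipschitzWith_ofLp 2 _).isBounded_preimage (Bornology.IsBounded.pi hs)

theorem coordinateBox_mono {t : Fin d → Set ℝ} (h : ∀ j, s j ⊆ t j) :
    coordinateBox s ⊆ coordinateBox t :=
  fun _ hx j => h j (hx j)

end

section

variable {d : ℕ} {L : ℝ} {S : Set (Space d)}

theorem dist_le_sqrt_mul {x y : Space d} (hL : 0 ≤ L) (h : ∀ j, dist (x j) (y j) ≤ L) :
    dist x y ≤ √d * L := by
  rw [EuclideanSpace.dist_eq, ← Real.sqrt_sq hL, ← Real.sqrt_mul (Nat.cast_nonneg d)]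
  refine Real.sqrt_le_sqrt ?_
  simpa using Finset.sum_le_card_nsmul Finset.univ (fun j => dist (x j) (y j) ^ 2) (L ^ 2)
    fun j _ => by gcongr; exact h j

theorem diam_le_of_subset_cube (hL : 0 ≤ L) (hS : S ⊆ coordinateBox fun _ => Set.Icc 0 L) :
    Metric.diam S ≤ √d * L :=
  Metric.diam_le_of_forall_dist_le (by positivity) fun x hx y hy => dist_le_sqrt_mul hL fun j =>
    by simpa using Real.dist_le_of_mem_Icc (hS hx j) (hS hy j)

theorem volume_of_between_cubes (hL : 0 ≤ L) (hS : coordinateBox (fun _ => Set.Ioo 0 L) ⊆ S)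
    (hS' : S ⊆ coordinateBox fun _ => Set.Icc 0 L) : volume S = ENNReal.ofReal (L ^ d) := by
  refine le_antisymm ((measure_mono hS').trans_eq ?_) (Eq.trans_le ?_ (measure_mono hS))
  · simp [volume_coordinateBox fun _ => measurableSet_Icc, ENNReal.ofReal_pow hL]
  · simp [volume_coordinateBox fun _ => measurableSet_Ioo, ENNReal.ofReal_pow hL]

theorem thickening_frontier_subset (hS : coordinateBox (fun _ => Set.Ioo 0 L) ⊆ S)
    (hS' : S ⊆ coordinateBox fun _ => Set.Icc 0 L) (δ : ℝ) :
    Metric.thickening δ (frontier S) ⊆ coordinateBox (fun _ => Set.Icc (-δ) (L + δ)) \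
      coordinateBox (fun _ => Set.Ioo δ (L - δ)) := by
  intro x hx
  obtain ⟨y, hy, hxy⟩ := Metric.mem_thickening_iff.1 hx
  have hcoord (j : Fin d) : |x j - y j| < δ := by
    rw [dist_eq_norm] at hxy
    exact (PiLp.norm_apply_le (x - y) j).trans_lt hxy
  have hclosed : y ∈ coordinateBox fun _ => Set.Icc 0 L :=
    closure_minimal hS' (isClosed_coordinateBox fun _ => isClosed_Icc) hy.1
  have hopen : y ∉ coordinateBox fun _ => Set.Ioo 0 L := fun h =>
    hy.2 (interior_maximal hS (isOpen_coordinateBox fun _ => isOpen_Ioo) h)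
  refine ⟨fun j => ?_, fun h => hopen fun j => ?_⟩
  · obtain ⟨hlo, hhi⟩ := abs_lt.1 (hcoord j)
    constructor <;> linarith [(hclosed j).1, (hclosed j).2]
  · obtain ⟨hlo, hhi⟩ := abs_lt.1 (hcoord j)
    constructor <;> linarith [(h j).1, (h j).2]

theorem volume_cubeShell {δ : ℝ} (hδ : 0 ≤ δ) (hδL : 2 * δ ≤ L) :
    volume (coordinateBox (fun _ : Fin d => Set.Icc (-δ) (L + δ)) \
      coordinateBox (fun _ => Set.Ioo δ (L - δ))) =
      ENNReal.ofReal ((L + 2 * δ) ^ d - (L - 2 * δ) ^ d) := by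
  have hinner : volume (coordinateBox fun _ : Fin d => Set.Ioo δ (L - δ)) =
      ENNReal.ofReal ((L - 2 * δ) ^ d) := by
    rw [volume_coordinateBox fun _ => measurableSet_Ioo, ENNReal.ofReal_pow (by linarith)]
    simp [two_mul, sub_sub]
  have houter : volume (coordinateBox fun _ : Fin d => Set.Icc (-δ) (L + δ)) =
      ENNReal.ofReal ((L + 2 * δ) ^ d) := by
    rw [volume_coordinateBox fun _ => measurableSet_Icc, ENNReal.ofReal_pow (by linarith)]
    simp [two_mul, add_assoc]
  rw [measure_sdiff (coordinateBox_mono fun _ => Set.Ioo_subset_Icc_self.trans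
      (Set.Icc_subset_Icc (by linarith) (by linarith)))
    (measurableSet_coordinateBox fun _ => measurableSet_Ioo).nullMeasurableSet
    (hinner ▸ ENNReal.ofReal_ne_top), hinner, houter,
    ENNReal.ofReal_sub _ (pow_nonneg (by linarith) d)]

theorem volume_thickening_frontier_le (hL : 0 ≤ L)
    (hS : coordinateBox (fun _ => Set.Ioo 0 L) ⊆ S) (hS' : S ⊆ coordinateBox fun _ => Set.Icc 0 L)
    {α : ℝ} (hα : 0 ≤ α) (hα' : 2 * (α * √d) ≤ 1) :
    volume (Metric.thickening (α * Metric.diam S) (frontier S)) ≤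
      ENNReal.ofReal ((1 + 2 * (α * √d)) ^ d - (1 - 2 * (α * √d)) ^ d) * volume S := by
  set δ : ℝ := α * √d * L
  have hdiam : α * Metric.diam S ≤ δ := by
    rw [show δ = α * (√d * L) from mul_assoc _ _ _]
    gcongr
    exact diam_le_of_subset_cube hL hS'
  have hshape : 0 ≤ (1 + 2 * (α * √d)) ^ d - (1 - 2 * (α * √d)) ^ d :=
    sub_nonneg.2 <| pow_le_pow_left₀ (by linarith) (by linarith [show 0 ≤ α * √d by positivity]) d
  calc volume (Metric.thickening (α * Metric.diam S) (frontier S))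
      ≤ volume (coordinateBox (fun _ : Fin d => Set.Icc (-δ) (L + δ)) \
          coordinateBox (fun _ => Set.Ioo δ (L - δ))) :=
        measure_mono <|
          (Metric.thickening_mono hdiam _).trans (thickening_frontier_subset hS hS' δ)
    _ = ENNReal.ofReal ((L + 2 * δ) ^ d - (L - 2 * δ) ^ d) :=
        volume_cubeShell (by positivity) <| by
          simpa only [δ, mul_assoc, one_mul] using mul_le_mul_of_nonneg_right hα' hL
    _ = _ := by
        rw [volume_of_between_cubes hL hS hS', ← ENNReal.ofReal_mul hshape, sub_mul, ← mul_pow,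
          ← mul_pow]
        congr 3 <;> ring

theorem tendsToInfinityFisher_of_between_cubes (hd : 0 < d) {S : ℕ → Set (Space d)} {L : ℕ → ℝ}
    (hL₀ : ∀ k, 0 ≤ L k) (hL : Tendsto L atTop atTop)
    (hS : ∀ k, coordinateBox (fun _ => Set.Ioo 0 (L k)) ⊆ S k)
    (hS' : ∀ k, S k ⊆ coordinateBox fun _ => Set.Icc 0 (L k)) : TendsToInfinityFisher S := by
  refine ⟨?_, fun α => (1 + 2 * (α * √d)) ^ d - (1 - 2 * (α * √d)) ^ d, ?_, 1 / (2 * √d),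
    by positivity, fun α hα hα' k =>
      volume_thickening_frontier_le (hL₀ k) (hS k) (hS' k) hα.le ?_⟩
  · simp only [volume_of_between_cubes (hL₀ _) (hS _) (hS' _)]
    exact ENNReal.tendsto_ofReal_atTop.comp ((tendsto_pow_atTop hd.ne').comp hL)
  · have hcont : Continuous fun α : ℝ => (1 + 2 * (α * √d)) ^ d - (1 - 2 * (α * √d)) ^ d := by
      fun_prop
    simpa using (hcont.tendsto 0).mono_left nhdsWithin_le_nhds
  · rw [lt_div_iff₀ (by positivity)] at hα'
    linarith

theorem thermodynamicLimit_of_between_cubes (hd : 0 < d) {ρ : ℝ} (hρ : 0 ≤ ρ)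
    {S : ℕ → Set (Space d)}
    (hS : ∀ k : ℕ, coordinateBox (fun _ => Set.Ioo 0 ((k : ℝ) + 1)) ⊆ S k)
    (hS' : ∀ k : ℕ, S k ⊆ coordinateBox fun _ => Set.Icc 0 ((k : ℝ) + 1)) :
    ThermodynamicLimit S (fun k => ⌊ρ * ((k : ℝ) + 1) ^ d⌋₊) ρ := by
  have hL : Tendsto (fun k : ℕ => (k : ℝ) + 1) atTop atTop :=
    tendsto_atTop_add_const_right _ _ tendsto_natCast_atTop_atTop
  refine ⟨tendsToInfinityFisher_of_between_cubes hd (fun k => by positivity) hL hS hS', ?_⟩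
  simp only [volume_of_between_cubes (Nat.cast_add_one_pos _).le (hS _) (hS' _)]
  refine ((tendsto_nat_floor_mul_div_atTop hρ).comp
    ((tendsto_pow_atTop hd.ne').comp hL)).congr fun k => ?_
  rw [ENNReal.toReal_ofReal (by positivity)]
  rfl

theorem exists_thermodynamicLimit_carrier (hd : 0 < d) {ρ : ℝ} (hρ : 0 ≤ ρ) :
    ∃ (Λ : ℕ → Domain d) (n : ℕ → ℕ), ThermodynamicLimit (fun k => (Λ k).carrier) n ρ :=
  ⟨fun k => ⟨coordinateBox fun _ => Set.Ioo 0 ((k : ℝ) + 1),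
      isOpen_coordinateBox fun _ => isOpen_Ioo,
      isBounded_coordinateBox fun _ => Metric.isBounded_Ioo _ _⟩, _,
    thermodynamicLimit_of_between_cubes hd hρ (fun _ => subset_rfl)
      fun _ => coordinateBox_mono fun _ => Set.Ioo_subset_Icc_self⟩

theorem exists_thermodynamicLimit_cells (hd : 0 < d) {ρ : ℝ} (hρ : 0 ≤ ρ) :
    ∃ (Λ : ℕ → Finset (Lattice d)) (n : ℕ → ℕ),
      ThermodynamicLimit (fun k => cells (Λ k)) n ρ := by
  refine ⟨fun k => Fintype.piFinset fun _ => Finset.Ico (0 : ℤ) (k + 1), _,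
    thermodynamicLimit_of_between_cubes hd hρ (fun k x hx => ?_) fun k x hx j => ?_⟩
  · refine Fintype.mem_piFinset.2 fun j => Finset.mem_Ico.2 ⟨Int.floor_nonneg.2 (hx j).1.le, ?_⟩
    rw [Int.floor_lt]
    exact_mod_cast (hx j).2
  · obtain ⟨hlo, hhi⟩ := Finset.mem_Ico.1 (Fintype.mem_piFinset.1 hx j)
    rw [Int.floor_lt] at hhi
    exact ⟨Int.floor_nonneg.1 hlo, by exact_mod_cast hhi.le⟩

end

theorem le_liminf_energy_div {D : Type*} {v : D → ℝ} {𝓔 : D → ℕ → EReal} {b s ρ : ℝ} (hρ : 0 < ρ)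
    (h : ∀ (Λ : D) (n : ℕ), 0 < n → 0 < v Λ →
      ((b * (n / v Λ) ^ s : ℝ) : EReal) ≤ 𝓔 Λ n / ((n : ℝ) : EReal))
    {Λ : ℕ → D} {n : ℕ → ℕ} (hlim : Tendsto (fun k => (n k : ℝ) / v (Λ k)) atTop (𝓝 ρ)) :
    ((b * ρ ^ s : ℝ) : EReal) ≤
      liminf (fun k => 𝓔 (Λ k) (n k) / ((n k : ℝ) : EReal)) atTop := by
  have hbound : Tendsto (fun k => ((b * ((n k : ℝ) / v (Λ k)) ^ s : ℝ) : EReal)) atTop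
      (𝓝 ((b * ρ ^ s : ℝ) : EReal)) :=
    (continuous_coe_real_ereal.tendsto _).comp <| (hlim.rpow_const (.inl hρ.ne')).const_mul b
  rw [← hbound.liminf_eq]
  refine liminf_le_liminf ?_
  filter_upwards [hlim.eventually_const_lt hρ] with k hk
  have hn : n k ≠ 0 := fun h0 => by simp [h0] at hk
  exact h _ _ (Nat.pos_of_ne_zero hn) ((div_pos_iff_of_pos_left (by positivity)).1 hk)

/- Convergence in probability does not give convergence at almost every `ω`: the bound is
transferred through the sets `⋂ k ≥ m, A k`, each of which is null because `P (A k) → 0`. -/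
theorem IsEnergyDensity.le_of_ae_le_liminf {Ω : Type*} [MeasurableSpace Ω] {P : Measure Ω}
    [NeZero P] {d : ℕ} {D : Type} {region : D → Set (Space d)} {𝓔 : Ω → D → ℕ → EReal} {ρ : ℝ}
    {e b : EReal} (he : IsEnergyDensity P region 𝓔 ρ e) {Λ : ℕ → D} {n : ℕ → ℕ}
    (hlim : ThermodynamicLimit (fun k => region (Λ k)) n ρ)
    (hb : ∀ᵐ ω ∂P, b ≤ liminf (fun k => 𝓔 ω (Λ k) (n k) / ((n k : ℝ) : EReal)) atTop) :
    b ≤ e := by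
  by_contra! hlt
  obtain ⟨c, hec, hcb⟩ := exists_between hlt
  set A : ℕ → Set Ω := fun k => {ω | 𝓔 ω (Λ k) (n k) / ((n k : ℝ) : EReal) ∉ Set.Iio c}
  have hA : Tendsto (fun k => P (A k)) atTop (𝓝 0) := he Λ n hlim _ (Iio_mem_nhds hec)
  have hnull (m : ℕ) : ∀ᵐ ω ∂P, ω ∉ ⋂ k ≥ m, A k := by
    refine measure_eq_zero_iff_ae_notMem.1 (le_zero_iff.1 (ge_of_tendsto hA ?_))
    filter_upwards [eventually_ge_atTop m] with k hk
    exact measure_mono (Set.biInter_subset_of_mem hk)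
  obtain ⟨ω, hωb, hω⟩ := (hb.and (ae_all_iff.2 hnull)).exists
  obtain ⟨m, hm⟩ := eventually_atTop.1 (eventually_lt_of_lt_liminf (hcb.trans_le hωb))
  exact hω m (Set.mem_iInter₂.2 fun k hk => (hm k hk).le.not_gt)

end FermionGas

theorem mainTheorem7_general (d : ℕ) (hd : 0 < d) :
    ∃ β : ℝ, 0 < β ∧
      ∀ (Ω : Type*) [MeasurableSpace Ω] (P : Measure Ω) [NeZero P] (ρ : ℝ), 0 < ρ →
        (∀ V : Ω → FermionGas.Space d → ℝ,
          (∀ᵐ ω ∂P, ∀ᵐ x, 0 ≤ V ω x) →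
          (∀ e : EReal,
            FermionGas.IsEnergyDensity P FermionGas.Domain.carrier
              (fun ω Λ n => FermionGas.groundEnergy (V ω) Λ n) ρ e →
            ((β * ρ ^ (2 / (d : ℝ)) : ℝ) : EReal) ≤ e) ∧
          (∀ᵐ ω ∂P, ∀ (Λ : ℕ → FermionGas.Domain d) (n : ℕ → ℕ),
            Tendsto (fun k => (n k : ℝ) / (volume (Λ k).carrier).toReal) atTop (𝓝 ρ) →
            ((β * ρ ^ (2 / (d : ℝ)) : ℝ) : EReal) ≤
              liminf (fun k => FermionGas.groundEnergy (V ω) (Λ k) (n k) /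
                ((n k : ℝ) : EReal)) atTop)) ∧
        (∀ V : Ω → FermionGas.Lattice d → ℝ,
          (∀ᵐ ω ∂P, ∀ x, 0 ≤ V ω x) →
          (∀ e : EReal,
            FermionGas.IsEnergyDensity P FermionGas.cells
              (fun ω Λ n => FermionGas.latticeGroundEnergy (V ω) Λ n) ρ e →
            ((β * ρ ^ (2 / (d : ℝ)) : ℝ) : EReal) ≤ e) ∧
          (∀ᵐ ω ∂P, ∀ (Λ : ℕ → Finset (FermionGas.Lattice d)) (n : ℕ → ℕ),
            Tendsto (fun k => (n k : ℝ) / (volume (FermionGas.cells (Λ k))).toReal) atTop (𝓝 ρ) →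
            ((β * ρ ^ (2 / (d : ℝ)) : ℝ) : EReal) ≤
              liminf (fun k => FermionGas.latticeGroundEnergy (V ω) (Λ k) (n k) /
                ((n k : ℝ) : EReal)) atTop)) := by
  refine ⟨FermionGas.energyConst d, FermionGas.energyConst_pos hd,
    fun Ω _ P _ ρ hρ => ⟨fun V hV => ?_, fun V hV => ?_⟩⟩
  · obtain ⟨Λ, n, hlim⟩ := FermionGas.exists_thermodynamicLimit_carrier hd hρ.le
    refine (and_iff_right_of_imp fun hliminf e he => ?_).2 (hV.mono fun ω hω Λ n hρn => ?_)
    · exact he.le_of_ae_le_liminf hlim (hliminf.mono fun ω hω => hω Λ n hlim.2)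
    · exact FermionGas.le_liminf_energy_div hρ
        (fun Λ _ hn hΛ => FermionGas.le_groundEnergy_div hd hω Λ hn hΛ) hρn
  · obtain ⟨Λ, n, hlim⟩ := FermionGas.exists_thermodynamicLimit_cells hd hρ.le
    refine (and_iff_right_of_imp fun hliminf e he => ?_).2 (hV.mono fun ω hω Λ n hρn => ?_)
    · exact he.le_of_ae_le_liminf hlim (hliminf.mono fun ω hω => hω Λ n hlim.2)
    · exact FermionGas.le_liminf_energy_div hρ
        (fun Λ _ hn _ => FermionGas.le_latticeGroundEnergy_div hd hω Λ hn) hρn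

theorem mainTheorem7 (d : ℕ) (hd : 0 < d) :
    ∃ β : ℝ, 0 < β ∧
      ∀ (Ω : Type*) [MeasurableSpace Ω] (P : Measure Ω) [IsProbabilityMeasure P]
        (ρ : ℝ), 0 < ρ →
        -- continuum model
        (∀ V : Ω → FermionGas.Space d → ℝ,
          (∀ᵐ ω ∂P, ∀ᵐ x, 0 ≤ V ω x) →
          (∀ e : EReal,
            FermionGas.IsEnergyDensity P FermionGas.Domain.carrier
              (fun ω Λ n => FermionGas.groundEnergy (V ω) Λ n) ρ e →
            ((β * ρ ^ (2 / (d : ℝ)) : ℝ) : EReal) ≤ e) ∧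
          (∀ᵐ ω ∂P, ∀ (Λ : ℕ → FermionGas.Domain d) (n : ℕ → ℕ),
            FermionGas.ThermodynamicLimit (fun k => (Λ k).carrier) n ρ →
            ((β * ρ ^ (2 / (d : ℝ)) : ℝ) : EReal) ≤
              liminf (fun k => FermionGas.groundEnergy (V ω) (Λ k) (n k) /
                ((n k : ℝ) : EReal)) atTop)) ∧
        -- lattice model
        (∀ V : Ω → FermionGas.Lattice d → ℝ,
          (∀ᵐ ω ∂P, ∀ x, 0 ≤ V ω x) →
          (∀ e : EReal,
            FermionGas.IsEnergyDensity P FermionGas.cells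
              (fun ω Λ n => FermionGas.latticeGroundEnergy (V ω) Λ n) ρ e →
            ((β * ρ ^ (2 / (d : ℝ)) : ℝ) : EReal) ≤ e) ∧
          (∀ᵐ ω ∂P, ∀ (Λ : ℕ → Finset (FermionGas.Lattice d)) (n : ℕ → ℕ),
            FermionGas.ThermodynamicLimit (fun k => FermionGas.cells (Λ k)) n ρ →
            ((β * ρ ^ (2 / (d : ℝ)) : ℝ) : EReal) ≤
              liminf (fun k => FermionGas.latticeGroundEnergy (V ω) (Λ k) (n k) /
                ((n k : ℝ) : EReal)) atTop)) := by
  obtain ⟨β, hβ, h⟩ := mainTheorem7_general d hd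
  exact ⟨β, hβ, fun Ω _ P _ ρ hρ => ⟨
    fun V hV => ((h Ω P ρ hρ).1 V hV).imp_right (·.mono fun _ hω Λ n hlim => hω Λ n hlim.2),
    fun V hV => ((h Ω P ρ hρ).2 V hV).imp_right (·.mono fun _ hω Λ n hlim => hω Λ n hlim.2)⟩⟩
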